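/- Let $n\ge 1$ and let $m_1,\dots,m_{n-1}$ be integers that are all positive or all negative. Let $L$ be the diagram of the closure of the braid word $\sigma_1^{m_1}\sigma_2^{m_2}\cdots\sigma_{n-1}^{m_{n-1}}$ on $n$ strands, drawn from top to bottom with all strands oriented downwards and closed up on the right, where $\sigma_i$ is a positive crossing of the strands in positions $i$ and $i+1$ (for $n=1$ it is the crossingless unknot). *Notation.* Let $\langle L\rangle=\sum_s A^{a(s)-b(s)}(-A^2-A^{-2})^{|s|-1}\in\mathbb Z[A^{\pm1}]$ be the Kauffman bracket, where $s$ runs over the choices of an $A$- or $B$-smoothing at every crossing, $a(s)$ and $b(s)$ count these, and $|s|$ is the number of resulting closed curves; at a positive crossing the $A$-smoothing is the one that respects the orientation. Let $wr(L)$ be the writhe and $J(L)=(-A^{-3})^{wr(L)}\langle L\rangle$ the Jones polynomial. Colour the faces of $L$ in checkerboard fashion with the outside face unshaded, and call a crossing checkerboard-positive if its $A$-smoothing merges its two shaded corners, and checkerboard-negative otherwise. Order the crossings, and omit one shaded and one unshaded face that touch along a strand. The balanced overlaid Tait graph $G$ is the bipartite graph whose vertices are the crossings and the remaining faces, a crossing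 being adjacent to the faces it touches. An edge at a shaded face $f$ has the letter $L$ if its crossing is the lowest ordered crossing that touches $f$, and $D$ otherwise; an edge at an unshaded face has $\ell$ or $d$ in the same way; letters at checkerboard-negative crossings get a bar. The weight $\mu(e)$ of an edge is $-A^{-3}$ for $L,\overline\ell$; $-A^{3}$ for $\ell,\overline L$; $A$ for $D,\overline d$; $A^{-1}$ for $d,\overline D$. *Theorem.* The ordering and the two omitted faces can be chosen such that $L$ admits a dimer model, that is $$\sum_{P}\prod_{e\in P}\mu(e)=\langle L\rangle ,$$ where $P$ runs over the perfect matchings of $G$, and such that moreover the following determinant formula holds. Let $M$ be the matrix with rows indexed by the crossings and columns by the remaining faces, whose entry at an adjacent pair is the weight of the edge, multiplied by $-1$ if the face lies between the two incoming strands of the crossing (Kauffman's trick for a Kasteleyn weighting), and whose other entries are $0$. Then $M$ is square, and for every identification of its rows with its columns $$J(L)=\pm\,(-A^{-3})^{wr(L)}\det M .$$ -/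

import Mathlib

/-! Closed braid diagrams, cut into horizontal levels, with their faces, Kauffman states,
bracket and Jones polynomials, balanced overlaid Tait graphs and dimer partition functions.

Laurent polynomials in the variable `A` are `LaurentPolynomial ℤ`, with `A ^ j = T j`. -/

noncomputable section

namespace ClosedBraid

open LaurentPolynomial

/-- A word in the generators `σ₁^{±1}, …, σ_k^{±1}` of the braid group on `k + 1` strands.
The letter `(i, 1)` is `σ_{i+1}` (as `Fin k` starts at `0`), the letter `(i, -1)` is its inverse.

The word is drawn from top to bottom with all strands oriented downwards, and the endpoint of every
strand position at the bottom is joined to the one at the top around the right-hand side.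
The letter `(i, 1)` is a positive (right-handed) crossing, so that the closure of
`σ₁ ^ 3` is the right-handed trefoil. -/
abbrev Word (k : ℕ) := List (Fin k × ℤˣ)

variable {k : ℕ}

/-- The word `σ₁^{m₁} σ₂^{m₂} ⋯ σ_k^{m_k}`. -/
def powerWord (m : Fin k → ℤ) : Word k :=
  (List.finRange k).flatMap fun i =>
    List.replicate (m i).natAbs (i, if 0 < m i then 1 else -1)

/-- The crossings of the closed braid diagram: one for each letter. -/
abbrev Crossing (w : Word k) := Fin w.length

/-- The levels of the diagram: the crossing `t` lies between level `t` (`t.castSucc`, above it)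
and level `t + 1` (`t.succ`, below it); the first and last level are joined by the closure. -/
abbrev Level (w : Word k) := Fin (w.length + 1)

/-- The sign of a crossing of the closed braid, for the downward orientation. -/
def sign (w : Word k) (t : Crossing w) : ℤˣ := (w.get t).2

/-- The left one of the two strand positions that meet at a crossing. -/
def leftStrand (w : Word k) (t : Crossing w) : Fin (k + 1) := (w.get t).1.castSucc

/-- The right one of the two strand positions that meet at a crossing. -/
def rightStrand (w : Word k) (t : Crossing w) : Fin (k + 1) := (w.get t).1.succ

/-! ### Bracket and Jones polynomials -/

/-- One step along the curves of the smoothed diagram. The points are the intersections of the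
strand positions with the levels. A state `s` assigns to each crossing the value `1`
(`A`-smoothing) or `-1` (`B`-smoothing). The `A`-smoothing of a positive crossing and the
`B`-smoothing of a negative crossing consist of two vertical arcs, the other two smoothings of
a cap and a cup. -/
inductive StateStep (w : Word k) (s : Crossing w → ℤˣ) :
    Fin (k + 1) × Level w → Fin (k + 1) × Level w → Prop
  | pass (t : Crossing w) (p : Fin (k + 1)) (hl : p ≠ leftStrand w t) (hr : p ≠ rightStrand w t) :
      StateStep w s (p, t.castSucc) (p, t.succ)
  | verticalLeft (t : Crossing w) (h : s t = sign w t) :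
      StateStep w s (leftStrand w t, t.castSucc) (leftStrand w t, t.succ)
  | verticalRight (t : Crossing w) (h : s t = sign w t) :
      StateStep w s (rightStrand w t, t.castSucc) (rightStrand w t, t.succ)
  | above (t : Crossing w) (h : s t ≠ sign w t) :
      StateStep w s (leftStrand w t, t.castSucc) (rightStrand w t, t.castSucc)
  | below (t : Crossing w) (h : s t ≠ sign w t) :
      StateStep w s (leftStrand w t, t.succ) (rightStrand w t, t.succ)
  | close (p : Fin (k + 1)) : StateStep w s (p, 0) (p, Fin.last _)

/-- The number of closed curves of a state. -/
def loopCount (w : Word k) (s : Crossing w → ℤˣ) : ℕ := Nat.card (Quot (StateStep w s))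

/-- The Kauffman bracket `∑ₛ A^{a(s) - b(s)} (-A² - A⁻²)^{|s| - 1}` of the closed braid diagram,
normalized to `1` on the unknot diagram without crossings
(there is at least one curve in every state). -/
def bracket (w : Word k) : LaurentPolynomial ℤ :=
  ∑ s : Crossing w → ℤˣ,
    T (∑ t, (s t : ℤ)) * (-T 2 - T (-2)) ^ (loopCount w s - 1)

/-- The writhe of the closed braid. -/
def writhe (w : Word k) : ℤ := ∑ t : Crossing w, (sign w t : ℤ)

/-- The correction term `(-A⁻³) ^ writhe`. -/
def writheFactor (w : Word k) : LaurentPolynomial ℤ :=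
  (writhe w).negOnePow • T (-3 * writhe w)

/-- The Jones polynomial, in the variable `A`. -/
def jones (w : Word k) : LaurentPolynomial ℤ := writheFactor w * bracket w

/-! ### Faces and checkerboard colouring -/

/-- The columns between the strand positions: column `0` is left of all strands, column `k + 1` is
right of all strands, and the strand position `p` separates `p.castSucc` from `p.succ`. This is the
column of the faces directly above and below a crossing. -/
def midColumn (w : Word k) (t : Crossing w) : Fin (k + 2) := (w.get t).1.castSucc.succ

/-- The column of the face to the left of a crossing. -/
def leftColumn (w : Word k) (t : Crossing w) : Fin (k + 2) := (w.get t).1.castSucc.castSucc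

/-- The column of the face to the right of a crossing. -/
def rightColumn (w : Word k) (t : Crossing w) : Fin (k + 2) := (w.get t).1.succ.succ

/-- A column at some level lies in the same face as this column at the next level unless the
crossing between them is in this column; the closure joins the first and the last level. -/
inductive FaceStep (w : Word k) : Fin (k + 2) × Level w → Fin (k + 2) × Level w → Prop
  | pass (t : Crossing w) (j : Fin (k + 2)) (h : j ≠ midColumn w t) :
      FaceStep w (j, t.castSucc) (j, t.succ)
  | close (j : Fin (k + 2)) : FaceStep w (j, 0) (j, Fin.last _)

/-- The faces of the closed braid diagram, the outside face included. -/
def Face (w : Word k) := Quot (FaceStep w)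

/-- The face that contains a given column at a given level. -/
def face (w : Word k) (j : Fin (k + 2)) (l : Level w) : Face w := Quot.mk _ (j, l)

instance (w : Word k) : Finite (Face w) := inferInstanceAs (Finite (Quot _))

instance (w : Word k) : Fintype (Face w) := Fintype.ofFinite _

/-- The column of a face. -/
def Face.column {w : Word k} (f : Face w) : Fin (k + 2) :=
  Quot.lift Prod.fst (by rintro _ _ (_ | _) <;> rfl) f

/-- The checkerboard colouring in which the outside face (column `0`) is not shaded:
the colour changes across every strand. -/
def Face.Shaded {w : Word k} (f : Face w) : Prop := Odd (f.column : ℕ)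

/-- Two faces touch along a strand of the diagram. -/
def Face.TouchAlongStrand {w : Word k} (f g : Face w) : Prop :=
  ∃ (p : Fin (k + 1)) (l : Level w),
    (f = face w p.castSucc l ∧ g = face w p.succ l) ∨
      (g = face w p.castSucc l ∧ f = face w p.succ l)

/-- The face above a crossing, between its two incoming strands. -/
def upperFace (w : Word k) (t : Crossing w) : Face w := face w (midColumn w t) t.castSucc

/-- The face below a crossing, between its two outgoing strands. -/
def lowerFace (w : Word k) (t : Crossing w) : Face w := face w (midColumn w t) t.succ

/-- The face to the left of a crossing. -/
def leftFace (w : Word k) (t : Crossing w) : Face w := face w (leftColumn w t) t.castSucc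

/-- The face to the right of a crossing. -/
def rightFace (w : Word k) (t : Crossing w) : Face w := face w (rightColumn w t) t.castSucc

/-- A crossing touches a face if the face occurs at one of its four corners. -/
def Touches (w : Word k) (t : Crossing w) (f : Face w) : Prop :=
  f = upperFace w t ∨ f = lowerFace w t ∨ f = leftFace w t ∨ f = rightFace w t

/-- The sign of a crossing with respect to the checkerboard colouring (not the orientation): it is
positive if the `A`-smoothing merges the two shaded corners. At a positive crossing of
the braid the `A`-smoothing merges the upper and the lower corner, at a negative one the
left and the right corner. -/
def CheckerboardPositive (w : Word k) (t : Crossing w) : Prop :=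
  if sign w t = 1 then (upperFace w t).Shaded else (leftFace w t).Shaded

/-! ### Activity letters -/

/-- The activity letters `L, ℓ, D, d` and their barred versions. -/
inductive ActivityLetter
  | L | l | D | d | Lbar | lbar | Dbar | dbar

/-- The activity letter specialization. -/
def ActivityLetter.specialize : ActivityLetter → LaurentPolynomial ℤ
  | L | lbar => -T (-3)
  | l | Lbar => -T 3
  | D | dbar => T 1
  | d | Dbar => T (-1)

/-! ### Balanced overlaid Tait graphs and dimer models -/

/-- The choices in the definition of a balanced overlaid Tait graph with activity letters:
an ordering of the crossings and two omitted faces, a shaded and an unshaded one, that touch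
along a strand. -/
structure BalancedOverlaidTait (w : Word k) where
  /-- The position of each crossing in the chosen ordering. -/
  rank : Crossing w ≃ Fin w.length
  /-- The omitted shaded face. -/
  omittedShaded : Face w
  /-- The omitted unshaded face. -/
  omittedUnshaded : Face w
  shaded : omittedShaded.Shaded
  unshaded : ¬ omittedUnshaded.Shaded
  touch : omittedShaded.TouchAlongStrand omittedUnshaded

namespace BalancedOverlaidTait

variable {w : Word k} (G : BalancedOverlaidTait w)

/-- The remaining faces; together with the crossings they are the vertices of the bipartite graph,
a crossing and a face being adjacent if they touch. -/
def FaceVertex : Type := {f : Face w // f ≠ G.omittedShaded ∧ f ≠ G.omittedUnshaded}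

instance : Finite G.FaceVertex := inferInstanceAs (Finite {_f : Face w // _})

instance : Fintype G.FaceVertex := Fintype.ofFinite _

open Classical in
/-- The edges of the balanced overlaid Tait graph. -/
def edges : Finset (Crossing w × G.FaceVertex) :=
  Finset.univ.filter fun e => Touches w e.1 e.2.1

/-- The crossing `t` is the lowest ordered neighbour of the face `f`. -/
def IsLowest (t : Crossing w) (f : G.FaceVertex) : Prop :=
  Touches w t f.1 ∧ ∀ t' : Crossing w, Touches w t' f.1 → G.rank t ≤ G.rank t'

open Classical in
/-- The activity letter of the edge between the crossing `t` and the face `f`. -/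
def letter (t : Crossing w) (f : G.FaceVertex) : ActivityLetter :=
  if CheckerboardPositive w t then
    if f.1.Shaded then (if G.IsLowest t f then .L else .D)
    else (if G.IsLowest t f then .l else .d)
  else
    if f.1.Shaded then (if G.IsLowest t f then .Lbar else .Dbar)
    else (if G.IsLowest t f then .lbar else .dbar)

/-- The specialized activity letter of an edge. -/
def weight (t : Crossing w) (f : G.FaceVertex) : LaurentPolynomial ℤ :=
  (G.letter t f).specialize

/-- A set of edges is a perfect matching if every vertex is incident to exactly one of them. -/
def IsPerfectMatching (P : Finset (Crossing w × G.FaceVertex)) : Prop :=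
  P ⊆ G.edges ∧ (∀ t : Crossing w, ∃! e, e ∈ P ∧ e.1 = t) ∧
    ∀ f : G.FaceVertex, ∃! e, e ∈ P ∧ e.2 = f

open Classical in
/-- The sum over all perfect matchings of the product of the weights of their edges. -/
def partitionFunction : LaurentPolynomial ℤ :=
  ∑ P ∈ G.edges.powerset.filter G.IsPerfectMatching, ∏ e ∈ P, G.weight e.1 e.2

/-- The graph is a dimer model of the diagram: its partition function is the bracket. -/
def IsDimerModel : Prop := G.partitionFunction = bracket w

open Classical in
/-- The modified adjacency matrix with rows the crossings, columns the remaining faces, and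
the signs of Kauffman's trick: the edge from a crossing to the face between its two
incoming strands is negative, all other edges are positive. -/
def kauffmanSignedMatrix : Matrix (Crossing w) G.FaceVertex (LaurentPolynomial ℤ) :=
  Matrix.of fun t f =>
    if Touches w t f.1 then
      (if f.1 = upperFace w t then -G.weight t f else G.weight t f)
    else 0

end BalancedOverlaidTait

end ClosedBraid

end

/-! In a word whose columns appear in increasing order, the closed curves of a state can be counted
column by column: a column with `n > 0` crossings smoothed into a cap and a cup adds `n - 1`
curves, each trapped between two successive such crossings, and a column with none separates the
outer curve on its right from the rest of the diagram. Hence the bracket is a product of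
contributions of the columns.

On the dimer side, match the first crossing of each column with the face to its right, and every
other crossing with the face above it. The resulting matrix of weights is block triangular with
respect to the columns and lower Hessenberg in each block. For a lower Hessenberg matrix the
permanent, here the dimer partition function, is the determinant after changing the signs above the
diagonal, and adding up the columns of a diagonal block evaluates it to the contribution of its
column to the bracket. Kauffman's signs only change whole matrix columns of each diagonal block. -/

namespace ClosedBraid

section LinearAlgebra

open Equiv Matrix

variable {R : Type*} [CommRing R]

theorem sign_eq_prod_of_le_add_one {n : ℕ} {σ : Perm (Fin n)} (h : ∀ i, (σ i : ℕ) ≤ i + 1) :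
    Perm.sign σ = ∏ i, if i < σ i then -1 else 1 := by
  induction n with
  | zero => simp [Subsingleton.elim σ 1]
  | succ n ih =>
    obtain ⟨⟨p, e⟩, rfl⟩ := Perm.decomposeFin.symm.surjective σ
    have hp : (p : ℕ) ≤ 1 := by simpa using h 0
    have hval (i : Fin n) : (Perm.decomposeFin.symm (p, e) i.succ : ℕ) =
        if (e i : ℕ) + 1 = p then 0 else (e i : ℕ) + 1 := by
      rw [Perm.decomposeFin_symm_apply_succ]
      split_ifs with hi
      · rw [show (e i).succ = p from Fin.ext hi, swap_apply_right, Fin.val_zero]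
      · rw [swap_apply_of_ne_of_ne (Fin.succ_ne_zero _) fun hi' => hi (congrArg Fin.val hi'),
          Fin.val_succ]
    have he (i : Fin n) : (e i : ℕ) ≤ i + 1 := by
      have := h i.succ
      rw [hval, Fin.val_succ] at this
      split_ifs at this <;> omega
    have hlt (i : Fin n) : i.succ < Perm.decomposeFin.symm (p, e) i.succ ↔ i < e i := by
      rw [Fin.lt_def, hval, Fin.lt_def, Fin.val_succ]
      split_ifs <;> omega
    rw [Perm.decomposeFin.symm_sign, ih he, Fin.prod_univ_succ, Perm.decomposeFin_symm_apply_zero]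
    simp only [hlt, Fin.pos_iff_ne_zero, ite_not]

theorem permanent_eq_det_of_hessenberg {n : ℕ} {A : Matrix (Fin n) (Fin n) R}
    (h : ∀ i j : Fin n, (i : ℕ) + 1 < j → A i j = 0) :
    A.permanent = (of fun i j => if i < j then -A i j else A i j).det := by
  rw [← permanent_transpose, ← det_transpose, permanent, det_apply']
  refine Finset.sum_congr rfl fun σ _ => ?_
  simp only [transpose_apply, of_apply]
  by_cases hσ : ∀ i, (σ i : ℕ) ≤ i + 1
  · rw [sign_eq_prod_of_le_add_one hσ, Units.coe_prod, Int.cast_prod, ← Finset.prod_mul_distrib]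
    refine Finset.prod_congr rfl fun i _ => ?_
    split_ifs <;> simp
  · push Not at hσ
    obtain ⟨i, hi⟩ := hσ
    have hzero := h i (σ i) hi
    rw [Finset.prod_eq_zero (Finset.mem_univ i) hzero,
      Finset.prod_eq_zero (Finset.mem_univ i) (by simp only [hzero, neg_zero, ite_self]), mul_zero]

theorem det_eq_prod_det_toSquareBlock {m α : Type*} [Fintype m] [DecidableEq m] [Fintype α]
    [LinearOrder α] {M : Matrix m m R} {b : m → α} (h : ∀ i j, b i < b j → M i j = 0) :
    M.det = ∏ a, (M.toSquareBlock b a).det := by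
  rw [← det_transpose, BlockTriangular.det_fintype (M := Mᵀ) (b := b) fun i j => h j i]
  exact Finset.prod_congr rfl fun a _ => det_transpose (M.toSquareBlock b a)

theorem det_eq_prod_mul_det_of_toSquareBlock {m α : Type*} [Fintype m] [DecidableEq m] [Finite α]
    [LinearOrder α] {M N : Matrix m m R} {b : m → α} {v : m → R}
    (hM : ∀ i j, b i < b j → M i j = 0) (hN : ∀ i j, b i < b j → N i j = 0)
    (h : ∀ i j, b i = b j → M i j = v j * N i j) : M.det = (∏ j, v j) * N.det := by
  have := Fintype.ofFinite α
  rw [← det_mul_row, det_eq_prod_det_toSquareBlock hM, det_eq_prod_det_toSquareBlock (b := b)]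
  · refine Finset.prod_congr rfl fun a _ => congrArg det ?_
    ext i j
    exact h i j (i.2.trans j.2.symm)
  · intro i j hij
    rw [of_apply, hN i j hij, mul_zero]

theorem exists_det_submatrix_eq_smul_det_submatrix {m n : Type*} [Fintype m] [DecidableEq m]
    (M : Matrix m n R) (e f : m ≃ n) :
    ∃ ε : ℤˣ, (M.submatrix id e).det = ε • (M.submatrix id f).det := by
  refine ⟨Perm.sign (e.trans f.symm), ?_⟩
  rw [Units.smul_def, zsmul_eq_mul, ← det_permute', submatrix_submatrix]
  congr 2
  ext
  simp

open Classical in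
/-- The block of one column of the diagram in a signed activity matrix, the crossings of the column
being ordered from top to bottom. The first crossing is matched with the face to the right of the
column and every other one with the face above it. The weights at a crossing of sign `ε` are
monomials in `x = A ^ ε` and `y = A ^ (-ε)`. -/
noncomputable def columnMatrix {α : Type*} [Preorder α] (x y : α → R) : Matrix α α R :=
  of fun r q =>
    if IsMin q then (if IsMin r then -x r ^ 3 else y r)
    else if q = r then x r else if r ⋖ q then y r ^ 3 else 0

theorem columnMatrix_zero {n : ℕ} (x y : Fin (n + 1) → R) (r : Fin (n + 1)) :
    columnMatrix x y r 0 = if r = 0 then -x r ^ 3 else y r := by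
  simp only [columnMatrix, of_apply, isMin_iff_eq_bot, bot_eq_zero, if_true]

theorem columnMatrix_succ {n : ℕ} (x y : Fin (n + 1) → R) (r : Fin (n + 1)) (q : Fin n) :
    columnMatrix x y r q.succ =
      (if q.succ = r then x r else 0) + if q.castSucc = r then y r ^ 3 else 0 := by
  simp only [columnMatrix, of_apply, isMin_iff_eq_bot, bot_eq_zero, Fin.succ_ne_zero, if_false]
  simp only [Fin.covBy_iff, Nat.covBy_iff_add_one_eq, Fin.ext_iff, Fin.val_succ, Fin.val_castSucc]
  split_ifs <;> first | omega | simp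

theorem sum_mul_columnMatrix {n : ℕ} {x y : Fin (n + 1) → R} {δ : R}
    (hxy : ∀ r, x r * y r = 1) (hδ : ∀ r, -x r ^ 2 - y r ^ 2 = δ) (r : Fin (n + 1)) :
    ∑ q, (if q = 0 then δ else 1) * columnMatrix x y r q =
      (if r = 0 then x r * (δ ^ 2 - 1) else 0) - (if r = Fin.last n then y r ^ 3 else 0) := by
  have hdiag : ∑ q : Fin n, (if q.succ = r then x r else 0) = if r = 0 then 0 else x r := by
    cases r using Fin.cases <;> simp [eq_comm]
  have hoff : ∑ q : Fin n, (if q.castSucc = r then y r ^ 3 else 0) =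
      if r = Fin.last n then 0 else y r ^ 3 := by
    cases r using Fin.lastCases <;> simp [eq_comm]
  rw [Fin.sum_univ_succ]
  simp only [if_true, Fin.succ_ne_zero, if_false, one_mul, columnMatrix_zero,
    columnMatrix_succ]
  rw [Finset.sum_add_distrib, hdiag, hoff]
  split_ifs <;> grind

theorem det_columnMatrix_submatrix_succ {n : ℕ} (x y : Fin (n + 1) → R) :
    ((columnMatrix x y).submatrix Fin.succ Fin.succ).det = ∏ r : Fin n, x r.succ := by
  rw [det_of_isUpperTriangular]
  · simp [columnMatrix_succ, Fin.castSucc_lt_succ.ne]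
  · intro i j (hij : j < i)
    rw [submatrix_apply, columnMatrix_succ, if_neg (Fin.succ_inj.not.2 hij.ne),
      if_neg (Fin.castSucc_lt_succ_iff.2 hij.le).ne, add_zero]

theorem det_columnMatrix_submatrix_castSucc {n : ℕ} (x y : Fin (n + 1) → R) :
    ((columnMatrix x y).submatrix Fin.castSucc Fin.succ).det = ∏ r : Fin n, y r.castSucc ^ 3 := by
  rw [det_of_isLowerTriangular]
  · simp [columnMatrix_succ, Fin.castSucc_lt_succ.ne']
  · intro i j (hij : i < j)
    rw [submatrix_apply, columnMatrix_succ, if_neg (Fin.castSucc_inj.not.2 hij.ne'),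
      if_neg (Fin.castSucc_lt_succ_iff.2 hij.le).ne', add_zero]

theorem mul_det_columnMatrix_fin {n : ℕ} {x y : Fin (n + 1) → R} {δ : R}
    (hxy : ∀ r, x r * y r = 1) (hδ : ∀ r, -x r ^ 2 - y r ^ 2 = δ) :
    δ * (columnMatrix x y).det = ∏ r, -y r ^ 3 + (∏ r, x r) * (δ ^ 2 - 1) := by
  -- `δ` times the first column plus all others vanishes outside the first and the last row.
  have hcol := det_updateCol_sum (columnMatrix x y) 0 fun q => if q = 0 then δ else 1
  simp only [if_true, smul_eq_mul, sum_mul_columnMatrix hxy hδ] at hcol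
  have hminor (r : Fin (n + 1)) (v : Fin (n + 1) → R) :
      ((columnMatrix x y).updateCol 0 v).submatrix r.succAbove Fin.succ =
        (columnMatrix x y).submatrix r.succAbove Fin.succ :=
    submatrix_updateCol_succAbove _ _ _ 0
  rw [← hcol, det_succ_column_zero]
  simp only [updateCol_self, hminor, mul_sub, sub_mul, Finset.sum_sub_distrib, mul_ite, ite_mul,
    mul_zero, zero_mul, Finset.sum_ite_eq', Finset.mem_univ, if_true, Fin.succAbove_zero,
    Fin.succAbove_last, det_columnMatrix_submatrix_succ, det_columnMatrix_submatrix_castSucc]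
  rw [Fin.prod_univ_succ x, Finset.prod_neg, Fin.prod_univ_castSucc (fun r => y r ^ 3)]
  simp only [Finset.card_univ, Fintype.card_fin, Fin.val_zero, Fin.val_last]
  ring

theorem mul_det_columnMatrix {α : Type*} [Fintype α] [LinearOrder α] [Nonempty α] {x y : α → R}
    {δ : R} (hxy : ∀ r, x r * y r = 1) (hδ : ∀ r, -x r ^ 2 - y r ^ 2 = δ) :
    δ * (columnMatrix x y).det = ∏ r, -y r ^ 3 + (∏ r, x r) * (δ ^ 2 - 1) := by
  obtain ⟨n, hn⟩ := Nat.exists_eq_succ_of_ne_zero (Fintype.card_ne_zero (α := α))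
  obtain ⟨e⟩ : Nonempty (Fin (n + 1) ≃o α) := ⟨Fintype.orderIsoFinOfCardEq α hn⟩
  have hmin (r : Fin (n + 1)) : IsMin (e r) ↔ IsMin r := by
    simp only [IsMin, e.surjective.forall, e.le_iff_le]
  have hM : (columnMatrix x y).submatrix e e = columnMatrix (x ∘ e) (y ∘ e) := by
    ext r q
    rw [submatrix_apply, columnMatrix, columnMatrix, of_apply, of_apply]
    rw [hmin q, hmin r, apply_covBy_apply_iff e, EmbeddingLike.apply_eq_iff_eq]
    rfl
  rw [← det_submatrix_equiv_self e.toEquiv, ← e.toEquiv.prod_comp, ← e.toEquiv.prod_comp x]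
  exact hM ▸ mul_det_columnMatrix_fin (fun r => hxy (e r)) fun r => hδ (e r)

end LinearAlgebra

section ColumnBracket

open LaurentPolynomial

/-- The value `-A² - A⁻²` of a closed curve in the Kauffman bracket. -/
noncomputable def loopValue : LaurentPolynomial ℤ := -T 2 - T (-2)

theorem neg_T_sq_sub_T_neg_sq (ε : ℤˣ) :
    -(T (ε : ℤ) ^ 2 : LaurentPolynomial ℤ) - T (-(ε : ℤ)) ^ 2 = loopValue := by
  rcases Int.units_eq_one_or ε with rfl | rfl <;> simp [loopValue, T_pow, sub_eq_add_neg, add_comm]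

theorem loopValue_ne_zero : loopValue ≠ 0 := by
  intro h
  have h_eval := congrArg (eval₂ (RingHom.id ℤ) 1) h
  norm_num [loopValue] at h_eval

theorem T_mul_T_neg (a : ℤ) : (T a * T (-a) : LaurentPolynomial ℤ) = 1 := by
  rw [← T_add, add_neg_cancel, T_zero]

/-- The number of closed curves that a column with `n` cup–cap smoothings adds to a state: the
curve on its right if there are none, and one curve between any two successive ones otherwise. -/
def columnLoops (n : ℕ) : ℕ := if n = 0 then 1 else n - 1

theorem loopValue_mul_pow_columnLoops (n : ℕ) :
    loopValue * loopValue ^ columnLoops n =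
      loopValue ^ n + if n = 0 then loopValue ^ 2 - 1 else 0 := by
  cases n with
  | zero => simp [columnLoops]; ring
  | succ n => simp [columnLoops, pow_succ']

variable {ι : Type*} [Fintype ι] [DecidableEq ι]

/-- The contribution of a column of crossings with signs `η` to the Kauffman bracket. -/
noncomputable def columnBracket (η : ι → ℤˣ) : LaurentPolynomial ℤ :=
  ∑ v : ι → ℤˣ, (∏ i, T (v i : ℤ)) * loopValue ^ columnLoops (Finset.card {i | v i ≠ η i})

theorem loopValue_mul_columnBracket (η : ι → ℤˣ) :
    loopValue * columnBracket η =
      ∏ i, -T (-(η i : ℤ)) ^ 3 + (∏ i, T (η i : ℤ)) * (loopValue ^ 2 - 1) := by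
  have hcrossing (ε : ℤˣ) : ∑ v : ℤˣ, (T (v : ℤ) * if v ≠ ε then loopValue else 1) =
      -T (-(ε : ℤ)) ^ 3 := by
    have hunits : (Finset.univ : Finset ℤˣ) = {ε, -ε} := by decide +revert
    rw [hunits, Finset.sum_pair (units_ne_neg_self ε), if_neg (not_not.2 rfl),
      if_pos (units_ne_neg_self ε).symm, ← neg_T_sq_sub_T_neg_sq ε, Units.val_neg]
    linear_combination (-T (ε : ℤ)) * T_mul_T_neg (ε : ℤ)
  have hstate (v : ι → ℤˣ) : ∏ i, (T (v i : ℤ) * if v i ≠ η i then loopValue else 1) =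
      (∏ i, T (v i : ℤ)) * loopValue ^ Finset.card {i | v i ≠ η i} := by
    rw [Finset.prod_mul_distrib, Finset.prod_ite, Finset.prod_const, Finset.prod_const_one, mul_one]
  have hvertical (v : ι → ℤˣ) : Finset.card {i | v i ≠ η i} = 0 ↔ v = η := by
    simp [Finset.filter_eq_empty_iff, funext_iff]
  have hsum : ∑ v : ι → ℤˣ, (∏ i, T (v i : ℤ)) * loopValue ^ Finset.card {i | v i ≠ η i} =
      ∏ i, -T (-(η i : ℤ)) ^ 3 := by
    rw [← Finset.prod_congr rfl fun i _ => hcrossing (η i), Finset.prod_univ_sum,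
      Fintype.piFinset_univ]
    exact Finset.sum_congr rfl fun v _ => (hstate v).symm
  rw [← hsum, columnBracket, Finset.mul_sum]
  simp only [mul_left_comm loopValue, loopValue_mul_pow_columnLoops, mul_add,
    Finset.sum_add_distrib, hvertical, mul_ite, mul_zero, Finset.sum_ite_eq', Finset.mem_univ,
    if_true]

theorem det_columnMatrix_eq_columnBracket {ι : Type*} [Fintype ι] [LinearOrder ι] [Nonempty ι]
    (η : ι → ℤˣ) :
    (columnMatrix (fun i => (T (η i : ℤ) : LaurentPolynomial ℤ)) fun i => T (-(η i : ℤ))).det =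
      columnBracket η :=
  mul_left_cancel₀ loopValue_ne_zero <|
    (mul_det_columnMatrix (fun i => T_mul_T_neg (η i)) fun i => neg_T_sq_sub_T_neg_sq (η i)).trans
      (loopValue_mul_columnBracket η).symm

end ColumnBracket

section States

variable {k : ℕ} (w : Word k)

/-- The index of the generator at a crossing: crossings with the same index form a column of the
diagram. -/
def crossingColumn (t : Crossing w) : Fin k := (w.get t).1

/-- The strand positions that meet at a crossing. -/
def OnStrand (t : Crossing w) (p : Fin (k + 1)) : Prop := p = leftStrand w t ∨ p = rightStrand w t

/-- The position at which the crossings of the columns to the right of the strand `p` begin, if the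
crossings are sorted by columns. -/
noncomputable def columnStart (p : Fin (k + 1)) : Level w :=
  Finset.sup {t | (crossingColumn w t).castSucc < p} Fin.succ

variable {w}

theorem OnStrand.of_crossingColumn_eq {t u : Crossing w} {p : Fin (k + 1)} (h : OnStrand w t p)
    (htu : crossingColumn w t = crossingColumn w u) : OnStrand w u p := by
  change p = (crossingColumn w t).castSucc ∨ p = (crossingColumn w t).succ at h
  rwa [htu] at h

theorem castSucc_lt_columnStart (hmono : Monotone (crossingColumn w)) {t : Crossing w}
    {p : Fin (k + 1)} : t.castSucc < columnStart w p ↔ (crossingColumn w t).castSucc < p := by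
  simp only [columnStart, Finset.lt_sup_iff, Finset.mem_filter_univ, Fin.castSucc_lt_succ_iff]
  exact ⟨fun ⟨u, hu, htu⟩ => (Fin.castSucc_le_castSucc_iff.2 (hmono htu)).trans_lt hu,
    fun h => ⟨t, h, le_rfl⟩⟩

theorem exists_apply_castSucc_ne {n : ℕ} {α : Type*} {q : Fin (n + 1) → α} {a b : Fin (n + 1)}
    (hab : a ≤ b) (hq : q a ≠ q b) :
    ∃ i : Fin n, a ≤ i.castSucc ∧ i.castSucc < b ∧ q i.castSucc ≠ q i.succ := by
  induction b using Fin.induction with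
  | zero => exact absurd (congrArg q (le_antisymm hab (Fin.zero_le a))) hq
  | succ i ih =>
    obtain rfl | hai := hab.eq_or_lt
    · exact absurd rfl hq
    have hai' : a ≤ i.castSucc := Fin.le_castSucc_iff.2 hai
    by_cases hi : q i.castSucc = q i.succ
    · obtain ⟨j, haj, hji, hj⟩ := ih hai' (hi ▸ hq)
      exact ⟨j, haj, hji.trans Fin.castSucc_lt_succ, hj⟩
    · exact ⟨i, hai', Fin.castSucc_lt_succ, hi⟩

variable (w) (s : Crossing w → ℤˣ)

/-- The crossings at which a state has a cap above a cup. -/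
def horizontal : Finset (Crossing w) := {t | s t ≠ sign w t}

/-- The level `l` lies in the pocket closed off from below by `t`, that is between two successive
cap–cup smoothings of the same column. -/
def InPocket (l : Level w) (t : Crossing w) : Prop :=
  IsLeast {u | u ∈ horizontal w s ∧ l ≤ u.castSucc} t ∧
    ∃ u ∈ horizontal w s, u.castSucc < l ∧ crossingColumn w u = crossingColumn w t

/-- The closed curve of a state through a point. -/
def curve (p : Fin (k + 1)) (l : Level w) : Quot (StateStep w s) := Quot.mk _ (p, l)

variable {w s}

theorem mem_horizontal {t : Crossing w} : t ∈ horizontal w s ↔ s t ≠ sign w t := by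
  simp [horizontal]

theorem InPocket.unique {l : Level w} {t u : Crossing w} (ht : InPocket w s l t)
    (hu : InPocket w s l u) : t = u :=
  ht.1.unique hu.1

theorem not_inPocket_zero {t : Crossing w} : ¬ InPocket w s 0 t :=
  fun ⟨_, _, _, h, _⟩ => absurd h (Fin.not_lt_zero _)

theorem not_inPocket_last {t : Crossing w} : ¬ InPocket w s (Fin.last _) t :=
  fun h => absurd h.1.1.2 (Fin.castSucc_lt_last t).not_ge

theorem exists_inPocket (hmono : Monotone (crossingColumn w)) {u v : Crossing w} {l : Level w}
    (hu : u ∈ horizontal w s) (hv : v ∈ horizontal w s) (hul : u.castSucc < l)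
    (hlv : l ≤ v.castSucc) (huv : crossingColumn w u = crossingColumn w v) :
    ∃ t, InPocket w s l t ∧ crossingColumn w t = crossingColumn w v := by
  obtain ⟨t, ht⟩ := (Set.toFinite {t | t ∈ horizontal w s ∧ l ≤ t.castSucc}).exists_minimal
    ⟨v, hv, hlv⟩
  have hleast := minimal_iff_isLeast.1 ht
  have htv : crossingColumn w t = crossingColumn w v :=
    (hmono (hleast.2 ⟨hv, hlv⟩)).antisymm
      (huv ▸ hmono (Fin.castSucc_le_castSucc_iff.1 (hul.le.trans hleast.1.2)))
  exact ⟨t, ⟨hleast, u, hu, hul, huv.trans htv.symm⟩, htv⟩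

theorem InPocket.eq_of_castSucc {t u : Crossing w} (ht : t ∈ horizontal w s)
    (hu : InPocket w s t.castSucc u) : u = t :=
  (hu.1.2 ⟨ht, le_rfl⟩).antisymm (Fin.castSucc_le_castSucc_iff.1 hu.1.1.2)

theorem InPocket.crossingColumn_eq_of_succ (hmono : Monotone (crossingColumn w))
    {t u : Crossing w} (hu : InPocket w s t.succ u) : crossingColumn w u = crossingColumn w t := by
  obtain ⟨⟨⟨-, htu⟩, -⟩, v, -, hvt, hvu⟩ := hu
  exact (hvu ▸ hmono (Fin.castSucc_lt_succ_iff.1 hvt)).antisymm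
    (hmono (Fin.succ_le_castSucc_iff.1 htu).le)

theorem inPocket_succ_of_notMem {t u : Crossing w} (ht : t ∉ horizontal w s) :
    InPocket w s t.succ u ↔ InPocket w s t.castSucc u := by
  have hle {v : Crossing w} (hv : v ∈ horizontal w s) : t.succ ≤ v.castSucc ↔ t ≤ v := by
    rw [Fin.succ_le_castSucc_iff, le_iff_lt_or_eq, or_iff_left (by rintro rfl; exact ht hv)]
  have hlt {v : Crossing w} (hv : v ∈ horizontal w s) : v.castSucc < t.succ ↔ v < t := by
    rw [← not_le, hle hv, not_le]
  have hset : {v | v ∈ horizontal w s ∧ t.succ ≤ v.castSucc} =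
      {v | v ∈ horizontal w s ∧ t.castSucc ≤ v.castSucc} :=
    Set.ext fun v => and_congr_right hle
  exact and_congr (by rw [hset]) (exists_congr fun v => and_congr_right fun hv =>
    and_congr_left fun _ => hlt hv)

open Classical in
variable (w s) in
/-- The leftmost strand position that an outer arc of the strand position `p` is joined to, an
arc being outer if it does not bound a pocket: it passes to the next column on the left at every
column that contains a cap–cup smoothing. -/
noncomputable def outerStrand (p : Fin (k + 1)) : Fin (k + 1) :=
  p.induction 0 fun j q => if ∃ t ∈ horizontal w s, crossingColumn w t = j then q else j.succ

theorem outerStrand_zero : outerStrand w s 0 = 0 := rfl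

theorem outerStrand_succ_of_mem {t : Crossing w} (ht : t ∈ horizontal w s) :
    outerStrand w s (crossingColumn w t).succ = outerStrand w s (crossingColumn w t).castSucc :=
  (Fin.induction_succ _ _ _).trans (if_pos ⟨t, ht, rfl⟩)

theorem outerStrand_succ_of_forall {j : Fin k}
    (h : ∀ t ∈ horizontal w s, crossingColumn w t ≠ j) : outerStrand w s j.succ = j.succ :=
  (Fin.induction_succ _ _ _).trans (if_neg fun ⟨t, ht, htj⟩ => h t ht htj)

theorem outerStrand_le (p : Fin (k + 1)) : outerStrand w s p ≤ p := by
  induction p using Fin.induction with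
  | zero => exact le_rfl
  | succ j ih =>
    by_cases h : ∃ t ∈ horizontal w s, crossingColumn w t = j
    · obtain ⟨t, ht, rfl⟩ := h
      exact (outerStrand_succ_of_mem ht).trans_le (ih.trans Fin.castSucc_lt_succ.le)
    · exact (outerStrand_succ_of_forall fun t ht htj => h ⟨t, ht, htj⟩).le

theorem outerStrand_succ_eq_self_iff {j : Fin k} :
    outerStrand w s j.succ = j.succ ↔ ∀ t ∈ horizontal w s, crossingColumn w t ≠ j := by
  refine ⟨?_, outerStrand_succ_of_forall⟩
  rintro h t ht rfl
  exact ((outerStrand_le _).trans_lt Fin.castSucc_lt_succ).ne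
    ((outerStrand_succ_of_mem ht).symm.trans h)

theorem outerStrand_outerStrand (p : Fin (k + 1)) :
    outerStrand w s (outerStrand w s p) = outerStrand w s p := by
  induction p using Fin.induction with
  | zero => rfl
  | succ j ih =>
    by_cases h : ∃ t ∈ horizontal w s, crossingColumn w t = j
    · obtain ⟨t, ht, rfl⟩ := h
      rw [outerStrand_succ_of_mem ht, ih]
    · rw [outerStrand_succ_of_forall fun t ht htj => h ⟨t, ht, htj⟩]
      exact outerStrand_succ_of_forall fun t ht htj => h ⟨t, ht, htj⟩

open Classical in
variable (w s) in
/-- A complete invariant of the closed curve through a point: the crossing that bounds its pocket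
from below, or else its leftmost strand position. -/
noncomputable def curveLabel (x : Fin (k + 1) × Level w) : Fin (k + 1) ⊕ Crossing w :=
  if h : ∃ t, OnStrand w t x.1 ∧ InPocket w s x.2 t then .inr h.choose
  else .inl (outerStrand w s x.1)

theorem curveLabel_of_inPocket {t : Crossing w} {p : Fin (k + 1)} {l : Level w}
    (hp : OnStrand w t p) (ht : InPocket w s l t) : curveLabel w s (p, l) = .inr t := by
  have h : ∃ t, OnStrand w t p ∧ InPocket w s l t := ⟨t, hp, ht⟩
  exact (dif_pos h).trans (congrArg _ (h.choose_spec.2.unique ht))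

theorem curveLabel_of_forall {p : Fin (k + 1)} {l : Level w}
    (h : ∀ t, OnStrand w t p → ¬ InPocket w s l t) :
    curveLabel w s (p, l) = .inl (outerStrand w s p) :=
  dif_neg fun ⟨t, hp, ht⟩ => h t hp ht

theorem curveLabel_congr {p : Fin (k + 1)} {l m : Level w}
    (h : ∀ t, OnStrand w t p → (InPocket w s l t ↔ InPocket w s m t)) :
    curveLabel w s (p, l) = curveLabel w s (p, m) := by
  by_cases hp : ∃ t, OnStrand w t p ∧ InPocket w s l t
  · obtain ⟨t, hp, ht⟩ := hp
    rw [curveLabel_of_inPocket hp ht, curveLabel_of_inPocket hp ((h t hp).1 ht)]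
  · rw [curveLabel_of_forall fun t htp ht => hp ⟨t, htp, ht⟩,
      curveLabel_of_forall fun t htp ht => hp ⟨t, htp, (h t htp).2 ht⟩]

theorem curveLabel_leftStrand_eq_rightStrand {t : Crossing w} {l : Level w}
    (ht : t ∈ horizontal w s)
    (h : ∀ u, InPocket w s l u → crossingColumn w u = crossingColumn w t) :
    curveLabel w s (leftStrand w t, l) = curveLabel w s (rightStrand w t, l) := by
  by_cases hu : ∃ u, InPocket w s l u
  · obtain ⟨u, hu⟩ := hu
    rw [curveLabel_of_inPocket (.of_crossingColumn_eq (.inl rfl) (h u hu).symm) hu,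
      curveLabel_of_inPocket (.of_crossingColumn_eq (.inr rfl) (h u hu).symm) hu]
  · rw [curveLabel_of_forall fun u _ h => hu ⟨u, h⟩, curveLabel_of_forall fun u _ h => hu ⟨u, h⟩]
    exact congrArg _ (outerStrand_succ_of_mem ht).symm

theorem curveLabel_eq_of_stateStep (hmono : Monotone (crossingColumn w))
    {x y : Fin (k + 1) × Level w} (h : StateStep w s x y) :
    curveLabel w s x = curveLabel w s y := by
  cases h with
  | pass t p hl hr =>
    refine curveLabel_congr fun u hu => ?_
    by_cases ht : t ∈ horizontal w s
    · have hp : ¬ OnStrand w t p := not_or.2 ⟨hl, hr⟩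
      exact iff_of_false (fun h => hp (h.eq_of_castSucc ht ▸ hu)) fun h =>
        hp (hu.of_crossingColumn_eq (h.crossingColumn_eq_of_succ hmono))
    · exact (inPocket_succ_of_notMem ht).symm
  | verticalLeft t h | verticalRight t h =>
    exact curveLabel_congr fun u _ => (inPocket_succ_of_notMem (by simp [mem_horizontal, h])).symm
  | above t h =>
    exact curveLabel_leftStrand_eq_rightStrand (mem_horizontal.2 h) fun u hu =>
      congrArg _ (hu.eq_of_castSucc (mem_horizontal.2 h))
  | below t h =>
    exact curveLabel_leftStrand_eq_rightStrand (mem_horizontal.2 h) fun u hu =>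
      hu.crossingColumn_eq_of_succ hmono
  | close p => exact curveLabel_congr fun t _ => iff_of_false not_inPocket_zero not_inPocket_last

theorem curve_leftStrand_castSucc {t : Crossing w} (ht : t ∈ horizontal w s) :
    curve w s (leftStrand w t) t.castSucc = curve w s (rightStrand w t) t.castSucc :=
  Quot.sound (.above t (mem_horizontal.1 ht))

theorem curve_leftStrand_succ {t : Crossing w} (ht : t ∈ horizontal w s) :
    curve w s (leftStrand w t) t.succ = curve w s (rightStrand w t) t.succ :=
  Quot.sound (.below t (mem_horizontal.1 ht))

theorem curve_zero (p : Fin (k + 1)) : curve w s p 0 = curve w s p (Fin.last _) :=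
  Quot.sound (.close p)

theorem curve_castSucc_eq_succ {t : Crossing w} {p : Fin (k + 1)}
    (h : t ∈ horizontal w s → ¬ OnStrand w t p) : curve w s p t.castSucc = curve w s p t.succ := by
  by_cases ht : t ∈ horizontal w s
  · exact Quot.sound (.pass t p (fun hl => h ht (.inl hl)) fun hr => h ht (.inr hr))
  · have hs : s t = sign w t := not_not.1 (mem_horizontal.not.1 ht)
    by_cases hl : p = leftStrand w t
    · exact hl ▸ Quot.sound (.verticalLeft t hs)
    by_cases hr : p = rightStrand w t
    · exact hr ▸ Quot.sound (.verticalRight t hs)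
    exact Quot.sound (.pass t p hl hr)

theorem exists_horizontal_of_curve_ne {p : Fin (k + 1)} {a b : Level w} (hab : a ≤ b)
    (h : curve w s p a ≠ curve w s p b) :
    ∃ t ∈ horizontal w s, OnStrand w t p ∧ a ≤ t.castSucc ∧ t.castSucc < b := by
  obtain ⟨t, hat, htb, ht⟩ := exists_apply_castSucc_ne hab h
  by_contra hne
  exact ht (curve_castSucc_eq_succ fun hmem hp => hne ⟨t, hmem, hp, hat, htb⟩)

theorem curve_eq_of_inPocket {t : Crossing w} {p : Fin (k + 1)} {l : Level w}
    (hp : OnStrand w t p) (ht : InPocket w s l t) :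
    curve w s p l = curve w s (rightStrand w t) t.castSucc := by
  have hpt : curve w s p t.castSucc = curve w s (rightStrand w t) t.castSucc := by
    obtain rfl | rfl := hp
    · exact curve_leftStrand_castSucc ht.1.1.1
    · rfl
  by_contra hne
  obtain ⟨u, hu, -, hlu, hut⟩ := exists_horizontal_of_curve_ne ht.1.1.2 (hpt ▸ hne)
  exact (ht.1.2 ⟨hu, hlu⟩).not_gt hut

theorem OnStrand.crossingColumn_eq (hmono : Monotone (crossingColumn w)) {t u : Crossing w}
    {p : Fin (k + 1)} (ht : OnStrand w t p) (hu : OnStrand w u p)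
    (htu : t.castSucc < columnStart w p ↔ u.castSucc < columnStart w p) :
    crossingColumn w t = crossingColumn w u := by
  change p = (crossingColumn w t).castSucc ∨ p = (crossingColumn w t).succ at ht
  change p = (crossingColumn w u).castSucc ∨ p = (crossingColumn w u).succ at hu
  simp only [castSucc_lt_columnStart hmono, Fin.lt_def, Fin.ext_iff, Fin.val_succ,
    Fin.val_castSucc] at ht hu htu ⊢
  lia

theorem curve_eq_or_eq_of_forall (hmono : Monotone (crossingColumn w)) {p : Fin (k + 1)}
    {l : Level w} (h : ∀ t, OnStrand w t p → ¬ InPocket w s l t) :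
    curve w s p l = curve w s p 0 ∨ curve w s p l = curve w s p (columnStart w p) := by
  have hpocket {u v : Crossing w} (hu : u ∈ horizontal w s) (hup : OnStrand w u p)
      (hul : u.castSucc < l) (hv : v ∈ horizontal w s) (hvp : OnStrand w v p)
      (hlv : l ≤ v.castSucc) : ¬ (u.castSucc < columnStart w p ↔ v.castSucc < columnStart w p) :=
    fun huv =>
      have ⟨t, ht, htv⟩ := exists_inPocket hmono hu hv hul hlv (hup.crossingColumn_eq hmono hvp huv)
      h t (hvp.of_crossingColumn_eq htv.symm) ht
  by_contra! hne
  obtain hl | hl := le_total l (columnStart w p)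
  · obtain ⟨u, hu, hup, -, hul⟩ := exists_horizontal_of_curve_ne (Fin.zero_le l) hne.1.symm
    obtain ⟨v, hv, hvp, hlv, hvl⟩ := exists_horizontal_of_curve_ne hl hne.2
    exact hpocket hu hup hul hv hvp hlv (iff_of_true (hul.trans_le hl) hvl)
  · obtain ⟨u, hu, hup, hlu, hul⟩ := exists_horizontal_of_curve_ne hl hne.2.symm
    obtain ⟨v, hv, hvp, hlv, -⟩ :=
      exists_horizontal_of_curve_ne (Fin.le_last l) (curve_zero (s := s) p ▸ hne.1)
    exact hpocket hu hup hul hv hvp hlv (iff_of_false hlu.not_gt (hl.trans hlv).not_gt)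

theorem OnStrand.curve_eq (hmono : Monotone (crossingColumn w)) {t : Crossing w} {p : Fin (k + 1)}
    {a b : Level w} (hp : OnStrand w t p) (hab : a ≤ b)
    (hside : ∀ u : Crossing w, a ≤ u.castSucc → u.castSucc < b →
      (u.castSucc < columnStart w p ↔ t.castSucc < columnStart w p))
    (h : ∀ u ∈ horizontal w s, crossingColumn w u = crossingColumn w t → a ≤ u.castSucc →
      b ≤ u.castSucc) :
    curve w s p a = curve w s p b := by
  by_contra hne
  obtain ⟨u, hu, hup, hau, hub⟩ := exists_horizontal_of_curve_ne hab hne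
  exact (h u hu (hup.crossingColumn_eq hmono hp (hside u hau hub)) hau).not_gt hub

theorem castSucc_lt_columnStart_rightStrand (hmono : Monotone (crossingColumn w))
    (t : Crossing w) : t.castSucc < columnStart w (rightStrand w t) :=
  (castSucc_lt_columnStart hmono).2 Fin.castSucc_lt_succ

theorem columnStart_leftStrand_le_castSucc (hmono : Monotone (crossingColumn w))
    (t : Crossing w) : columnStart w (leftStrand w t) ≤ t.castSucc :=
  not_lt.1 fun h => ((castSucc_lt_columnStart hmono).1 h).false

theorem curve_succ_zero (hmono : Monotone (crossingColumn w)) {j : Fin k} {t : Crossing w}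
    (ht : IsLeast {u | u ∈ horizontal w s ∧ crossingColumn w u = j} t) :
    curve w s j.succ 0 = curve w s j.castSucc (columnStart w j.castSucc) := by
  obtain ⟨⟨ht, rfl⟩, hfirst⟩ := ht
  have hright := castSucc_lt_columnStart_rightStrand hmono t
  have hleft := columnStart_leftStrand_le_castSucc hmono t
  calc
    _ = curve w s (rightStrand w t) t.castSucc :=
      OnStrand.curve_eq hmono (.inr rfl) (Fin.zero_le _)
        (fun u _ hu => iff_of_true (hu.trans hright) hright) fun u hu htu _ =>
        Fin.castSucc_le_castSucc_iff.2 (hfirst ⟨hu, htu⟩)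
    _ = curve w s (leftStrand w t) t.castSucc := (curve_leftStrand_castSucc ht).symm
    _ = _ := .symm <| OnStrand.curve_eq hmono (.inl rfl) hleft
        (fun u hu _ => iff_of_false hu.not_gt hleft.not_gt) fun u hu htu _ =>
        Fin.castSucc_le_castSucc_iff.2 (hfirst ⟨hu, htu⟩)

theorem curve_succ_columnStart (hmono : Monotone (crossingColumn w)) {j : Fin k} {t : Crossing w}
    (ht : IsGreatest {u | u ∈ horizontal w s ∧ crossingColumn w u = j} t) :
    curve w s j.succ (columnStart w j.succ) = curve w s j.castSucc 0 := by
  obtain ⟨⟨ht, rfl⟩, hlast⟩ := ht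
  have hright := castSucc_lt_columnStart_rightStrand hmono t
  have hleft := columnStart_leftStrand_le_castSucc hmono t
  have hnone {u : Crossing w} {b : Level w} (hu : u ∈ horizontal w s)
      (hut : crossingColumn w u = crossingColumn w t) (htu : t.succ ≤ u.castSucc) :
      b ≤ u.castSucc :=
    absurd (hlast ⟨hu, hut⟩) (Fin.succ_le_castSucc_iff.1 htu).not_ge
  calc
    _ = curve w s (rightStrand w t) t.succ :=
      .symm <| OnStrand.curve_eq hmono (.inr rfl) (Fin.castSucc_lt_iff_succ_le.1 hright)
        (fun u _ hu => iff_of_true hu hright) fun u hu hut htu => hnone hu hut htu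
    _ = curve w s (leftStrand w t) t.succ := (curve_leftStrand_succ ht).symm
    _ = curve w s (leftStrand w t) (Fin.last _) :=
      OnStrand.curve_eq hmono (.inl rfl) (Fin.le_last _)
        (fun u hu _ => iff_of_false
          (hleft.trans (Fin.castSucc_lt_succ.le.trans hu)).not_gt hleft.not_gt)
        fun u hu hut htu => hnone hu hut htu
    _ = _ := (curve_zero _).symm

-- Both arcs of a strand that bound no pocket turn into those of the strand to its left, with their
-- roles exchanged, so it is enough that they are joined on the leftmost strand.
theorem curve_columnStart (hmono : Monotone (crossingColumn w)) (p : Fin (k + 1)) :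
    curve w s p (columnStart w p) = curve w s p 0 := by
  induction p using Fin.induction with
  | zero =>
    by_contra hne
    obtain ⟨t, -, -, -, ht⟩ := exists_horizontal_of_curve_ne (Fin.zero_le _) (Ne.symm hne)
    exact absurd ((castSucc_lt_columnStart hmono).1 ht) (Fin.not_lt_zero _)
  | succ j ih =>
    obtain hj | hj :=
      Set.eq_empty_or_nonempty {t | t ∈ horizontal w s ∧ crossingColumn w t = j}
    · by_contra hne
      obtain ⟨t, ht, hp, -, htj⟩ := exists_horizontal_of_curve_ne (Fin.zero_le _) (Ne.symm hne)
      refine Set.eq_empty_iff_forall_notMem.1 hj t ⟨ht, hp.elim (fun hp => ?_) fun hp => ?_⟩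
      · exact absurd ((castSucc_lt_columnStart hmono).1 htj) hp.not_gt
      · exact (Fin.succ_inj.1 hp).symm
    · obtain ⟨a, ha⟩ := (Set.toFinite _).exists_minimal hj
      obtain ⟨b, hb⟩ := (Set.toFinite _).exists_maximal hj
      rw [curve_succ_columnStart hmono (maximal_iff_isGreatest.1 hb),
        curve_succ_zero hmono (minimal_iff_isLeast.1 ha), ih]

theorem curve_outerStrand (hmono : Monotone (crossingColumn w)) (p : Fin (k + 1)) :
    curve w s (outerStrand w s p) 0 = curve w s p 0 := by
  induction p using Fin.induction with
  | zero => rfl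
  | succ j ih =>
    obtain hj | hj :=
      Set.eq_empty_or_nonempty {t | t ∈ horizontal w s ∧ crossingColumn w t = j}
    · rw [outerStrand_succ_of_forall fun t ht htj =>
        Set.eq_empty_iff_forall_notMem.1 hj t ⟨ht, htj⟩]
    · obtain ⟨a, ha⟩ := (Set.toFinite _).exists_minimal hj
      rw [curve_succ_zero hmono (minimal_iff_isLeast.1 ha), curve_columnStart hmono, ← ih]
      obtain ⟨⟨ha, rfl⟩, -⟩ := ha
      rw [outerStrand_succ_of_mem ha]

variable (w s) in
/-- A point on the curve with a given label. -/
def curveOfLabel : Fin (k + 1) ⊕ Crossing w → Quot (StateStep w s) :=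
  Sum.elim (fun p => curve w s p 0) fun t => curve w s (rightStrand w t) t.castSucc

theorem curveOfLabel_curveLabel (hmono : Monotone (crossingColumn w))
    (x : Fin (k + 1) × Level w) : curveOfLabel w s (curveLabel w s x) = Quot.mk _ x := by
  obtain ⟨p, l⟩ := x
  by_cases h : ∃ t, OnStrand w t p ∧ InPocket w s l t
  · obtain ⟨t, hp, ht⟩ := h
    rw [curveLabel_of_inPocket hp ht]
    exact (curve_eq_of_inPocket hp ht).symm
  · have h' (t : Crossing w) (hp : OnStrand w t p) (ht : InPocket w s l t) : False := h ⟨t, hp, ht⟩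
    rw [curveLabel_of_forall h']
    refine (curve_outerStrand hmono p).trans ?_
    obtain hl | hl := curve_eq_or_eq_of_forall hmono h'
    · exact hl.symm
    · exact (hl.trans (curve_columnStart hmono p)).symm

theorem range_curveLabel :
    Set.range (curveLabel w s) =
      (Finset.disjSum {p | outerStrand w s p = p} {t ∈ horizontal w s |
        ∃ u ∈ horizontal w s, u < t ∧ crossingColumn w u = crossingColumn w t} : Finset _) := by
  ext y
  simp only [Finset.mem_coe, Set.mem_range]
  constructor
  · rintro ⟨⟨p, l⟩, rfl⟩
    by_cases h : ∃ t, OnStrand w t p ∧ InPocket w s l t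
    · obtain ⟨t, hp, ht⟩ := h
      obtain ⟨⟨⟨htH, hlt⟩, -⟩, u, hu, hul, hut⟩ := id ht
      rw [curveLabel_of_inPocket hp ht, Finset.inr_mem_disjSum, Finset.mem_filter]
      exact ⟨htH, u, hu, Fin.castSucc_lt_castSucc_iff.1 (hul.trans_le hlt), hut⟩
    · rw [curveLabel_of_forall fun t hp ht => h ⟨t, hp, ht⟩, Finset.inl_mem_disjSum,
        Finset.mem_filter_univ, outerStrand_outerStrand]
  · obtain p | t := y
    · intro hp
      rw [Finset.inl_mem_disjSum, Finset.mem_filter_univ] at hp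
      exact ⟨(p, 0), by rw [curveLabel_of_forall fun _ _ => not_inPocket_zero, hp]⟩
    · intro ht
      rw [Finset.inr_mem_disjSum, Finset.mem_filter] at ht
      obtain ⟨ht, u, hu, hut⟩ := ht
      exact ⟨(rightStrand w t, t.castSucc), curveLabel_of_inPocket (.inr rfl)
        ⟨⟨⟨ht, le_rfl⟩, fun v hv => Fin.castSucc_le_castSucc_iff.1 hv.2⟩, u, hu, hut⟩⟩

theorem card_outerStrand_eq_self :
    Finset.card {p | outerStrand w s p = p} =
      1 + ∑ j, if Finset.card {t ∈ horizontal w s | crossingColumn w t = j} = 0 then 1 else 0 := by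
  rw [Fin.card_filter_univ_succ, if_pos outerStrand_zero, Finset.card_filter, add_comm]
  simp only [outerStrand_succ_eq_self_iff, Finset.card_eq_zero, Finset.filter_eq_empty_iff]

theorem card_filter_exists_lt {α : Type*} [LinearOrder α] (S : Finset α) :
    Finset.card {t ∈ S | ∃ u ∈ S, u < t} = S.card - 1 := by
  obtain rfl | hS := S.eq_empty_or_nonempty
  · rfl
  · rw [← Finset.card_erase_of_mem (S.min'_mem hS)]
    congr 1
    ext t
    rw [Finset.mem_filter, Finset.mem_erase]
    exact ⟨fun ⟨ht, u, hu, hut⟩ => ⟨((S.min'_le u hu).trans_lt hut).ne', ht⟩, fun ⟨hne, ht⟩ =>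
      ⟨ht, _, S.min'_mem hS, (S.min'_le t ht).lt_of_ne' hne⟩⟩

theorem card_filter_exists_lt_crossingColumn_eq (S : Finset (Crossing w)) :
    Finset.card {t ∈ S | ∃ u ∈ S, u < t ∧ crossingColumn w u = crossingColumn w t} =
      ∑ j, (Finset.card {t ∈ S | crossingColumn w t = j} - 1) := by
  rw [Finset.card_eq_sum_card_fiberwise (f := crossingColumn w) (t := Finset.univ)
    fun _ _ => Finset.mem_univ _]
  refine Finset.sum_congr rfl fun j _ => ?_
  rw [← card_filter_exists_lt]
  congr 1
  ext t
  simp only [Finset.mem_filter]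
  grind

theorem loopCount_eq (hmono : Monotone (crossingColumn w)) :
    loopCount w s =
      1 + ∑ j, columnLoops (Finset.card {t ∈ horizontal w s | crossingColumn w t = j}) := by
  have hlabel : Function.LeftInverse (curveOfLabel w s)
      (Quot.lift (curveLabel w s) fun _ _ => curveLabel_eq_of_stateStep hmono) := by
    rintro ⟨x⟩
    exact curveOfLabel_curveLabel hmono x
  have hsplit (n : ℕ) : columnLoops n = (if n = 0 then 1 else 0) + (n - 1) := by
    unfold columnLoops; split_ifs <;> lia
  rw [loopCount, ← Nat.card_range_of_injective hlabel.injective, Set.range_quot_lift,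
    range_curveLabel, Nat.card_coe_set_eq, Set.ncard_coe_finset, Finset.card_disjSum,
    card_outerStrand_eq_self, card_filter_exists_lt_crossingColumn_eq, add_assoc,
    ← Finset.sum_add_distrib]
  simp only [hsplit]

open LaurentPolynomial

theorem T_sum {ι : Type*} (S : Finset ι) (f : ι → ℤ) :
    (T (∑ i ∈ S, f i) : LaurentPolynomial ℤ) = ∏ i ∈ S, T (f i) :=
  map_prod (AddMonoidAlgebra.of ℤ ℤ) (fun i => Multiplicative.ofAdd (f i)) S

theorem bracket_eq_prod_columnBracket (hmono : Monotone (crossingColumn w)) :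
    bracket w = ∏ j, columnBracket fun t : {t // crossingColumn w t = j} => sign w t := by
  simp only [columnBracket, Finset.prod_univ_sum, Fintype.piFinset_univ]
  let split : (Crossing w → ℤˣ) ≃ ∀ j, {t // crossingColumn w t = j} → ℤˣ :=
    ((Equiv.sigmaFiberEquiv (crossingColumn w)).symm.arrowCongr (.refl _)).trans
      (Equiv.piCurry fun _ _ => ℤˣ)
  refine Fintype.sum_equiv split _ _ fun s => ?_
  have hprod : ∏ j, ∏ t, T (split s j t : ℤ) = (T (∑ t, (s t : ℤ)) : LaurentPolynomial ℤ) := by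
    rw [T_sum, ← Fintype.prod_fiberwise (crossingColumn w)]
    rfl
  have hcard (j : Fin k) : Finset.card {t ∈ horizontal w s | crossingColumn w t = j} =
      Finset.card {t : {t // crossingColumn w t = j} | split s j t ≠ sign w t} := by
    rw [← Finset.card_subtype]
    exact congrArg Finset.card (Finset.ext fun t => by
      rw [Finset.mem_subtype, mem_horizontal, Finset.mem_filter_univ]; rfl)
  rw [Finset.prod_mul_distrib, hprod, Finset.prod_pow_eq_pow_sum, loopCount_eq hmono,
    Nat.add_sub_cancel_left]
  simp only [hcard]
  rfl

end States

section Matchings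

variable {α β : Type*} [Fintype α]

/-- The graph of a bijection, as a finite set of pairs. -/
def graphFinset (f : α ≃ β) : Finset (α × β) :=
  Finset.univ.map ⟨fun a => (a, f a), fun _ _ h => congrArg Prod.fst h⟩

theorem mem_graphFinset {f : α ≃ β} {e : α × β} : e ∈ graphFinset f ↔ f e.1 = e.2 := by
  rw [graphFinset, Finset.mem_map]
  exact ⟨fun ⟨_, _, h⟩ => h ▸ rfl, fun h => ⟨e.1, Finset.mem_univ _, Prod.ext rfl h⟩⟩

theorem graphFinset_injective : Function.Injective (graphFinset : α ≃ β → Finset (α × β)) :=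
  fun f g h => Equiv.ext fun a =>
    (mem_graphFinset.1 (h ▸ mem_graphFinset.2 rfl : (a, f a) ∈ graphFinset g)).symm

theorem prod_graphFinset {R : Type*} [CommMonoid R] (f : α ≃ β) (g : α × β → R) :
    ∏ e ∈ graphFinset f, g e = ∏ a, g (a, f a) :=
  Finset.prod_map _ _ _

theorem exists_graphFinset_eq_iff {P : Finset (α × β)} :
    (∃ f, graphFinset f = P) ↔
      (∀ a, ∃! e, e ∈ P ∧ e.1 = a) ∧ ∀ b, ∃! e, e ∈ P ∧ e.2 = b := by
  constructor
  · rintro ⟨f, rfl⟩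
    simp only [mem_graphFinset]
    refine ⟨fun a => ⟨(a, f a), ⟨rfl, rfl⟩, ?_⟩,
      fun b => ⟨(f.symm b, b), ⟨f.apply_symm_apply b, rfl⟩, ?_⟩⟩
    · rintro e ⟨he, rfl⟩
      exact Prod.ext rfl he.symm
    · rintro e ⟨he, rfl⟩
      exact Prod.ext (f.eq_symm_apply.2 he) rfl
  · rintro ⟨hα, hβ⟩
    choose e he he_unique using hα
    choose e' he' he'_unique using hβ
    refine ⟨⟨fun a => (e a).2, fun b => (e' b).1, fun a => ?_, fun b => ?_⟩, ?_⟩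
    · exact (congrArg Prod.fst (he'_unique _ (e a) ⟨(he a).1, rfl⟩)).symm.trans (he a).2
    · exact (congrArg Prod.snd (he_unique _ (e' b) ⟨(he' b).1, rfl⟩)).symm.trans (he' b).2
    · ext p
      rw [mem_graphFinset]
      exact ⟨fun hp => (Prod.ext (he p.1).2 hp : e p.1 = p) ▸ (he p.1).1,
        fun hp => congrArg Prod.snd (he_unique p.1 p ⟨hp, rfl⟩).symm⟩

namespace BalancedOverlaidTait

variable {k : ℕ} {w : Word k} (G : BalancedOverlaidTait w)

open Classical in
/-- The weighted biadjacency matrix of the balanced overlaid Tait graph. -/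
noncomputable def activityMatrix : Matrix (Crossing w) G.FaceVertex (LaurentPolynomial ℤ) :=
  .of fun t f => if Touches w t f.1 then G.weight t f else 0

variable {G}

open Classical in
theorem kauffmanSignedMatrix_eq_activityMatrix (t : Crossing w) (f : G.FaceVertex) :
    G.kauffmanSignedMatrix t f =
      if f.1 = upperFace w t then -G.activityMatrix t f else G.activityMatrix t f := by
  simp only [kauffmanSignedMatrix, activityMatrix, Matrix.of_apply]
  split_ifs <;> simp

theorem isPerfectMatching_iff {P : Finset (Crossing w × G.FaceVertex)} :
    G.IsPerfectMatching P ↔ P ⊆ G.edges ∧ ∃ f, graphFinset f = P :=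
  and_congr_right fun _ => exists_graphFinset_eq_iff.symm

theorem prod_activityMatrix (f : Crossing w ≃ G.FaceVertex) [Decidable (graphFinset f ⊆ G.edges)] :
    ∏ t, G.activityMatrix t (f t) =
      if graphFinset f ⊆ G.edges then ∏ e ∈ graphFinset f, G.weight e.1 e.2 else 0 := by
  classical
  have hsub : graphFinset f ⊆ G.edges ↔ ∀ t, Touches w t (f t).1 := by
    simp [Finset.subset_iff, mem_graphFinset, edges]
  simp only [prod_graphFinset, hsub, activityMatrix, Matrix.of_apply, Finset.prod_ite_zero,
    Finset.mem_univ, true_implies]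

theorem partitionFunction_eq_permanent (e : Crossing w ≃ G.FaceVertex) :
    G.partitionFunction = (G.activityMatrix.submatrix id e).permanent := by
  classical
  have hmatchings : G.edges.powerset.filter G.IsPerfectMatching =
      (Finset.univ.filter fun σ : Equiv.Perm (Crossing w) =>
        graphFinset (σ.trans e) ⊆ G.edges).image
        fun σ => graphFinset (σ.trans e) := by
    ext P
    simp only [Finset.mem_filter, Finset.mem_powerset, isPerfectMatching_iff, Finset.mem_image,
      Finset.mem_univ, true_and]
    constructor
    · rintro ⟨hP, -, f, rfl⟩
      exact ⟨f.trans e.symm, by simpa [Equiv.trans_assoc] using hP, by simp [Equiv.trans_assoc]⟩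
    · rintro ⟨σ, hσ, rfl⟩
      exact ⟨hσ, hσ, _, rfl⟩
  have hinj : Function.Injective fun σ : Equiv.Perm (Crossing w) => graphFinset (σ.trans e) :=
    graphFinset_injective.comp fun σ τ h => by simpa [Equiv.ext_iff] using h
  rw [partitionFunction, hmatchings, Finset.sum_image hinj.injOn, Finset.sum_filter,
    ← Matrix.permanent_transpose]
  exact Finset.sum_congr rfl fun σ _ => (prod_activityMatrix _).symm

end BalancedOverlaidTait

end Matchings

section Faces

variable {k : ℕ} (w : Word k)

/-- No other crossing of the column lies above `t`. -/
def IsFirstInColumn (t : Crossing w) : Prop := ∀ u < t, crossingColumn w u ≠ crossingColumn w t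

variable {w}

theorem IsFirstInColumn.eq_of_crossingColumn_eq {t u : Crossing w} (ht : IsFirstInColumn w t)
    (hu : IsFirstInColumn w u) (htu : crossingColumn w t = crossingColumn w u) : t = u :=
  (not_lt.1 fun h => ht u h htu.symm).antisymm (not_lt.1 fun h => hu t h htu)

theorem IsFirstInColumn.le_of_crossingColumn_le (hmono : Monotone (crossingColumn w))
    {t u : Crossing w} (hu : IsFirstInColumn w u) (h : crossingColumn w u ≤ crossingColumn w t) :
    u ≤ t :=
  not_lt.1 fun htu => hu t htu ((hmono htu.le).antisymm h)

theorem exists_isFirstInColumn_of_surjective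
    (hsurj : Function.Surjective (crossingColumn w)) (j : Fin k) :
    ∃ t, IsFirstInColumn w t ∧ crossingColumn w t = j := by
  obtain ⟨t, ht⟩ := (Set.toFinite {t | crossingColumn w t = j}).exists_minimal (hsurj j)
  exact ⟨t, fun u hu h => ht.not_lt (h.trans ht.prop) hu, ht.prop⟩

theorem castSucc_ne_zero_of_not_isFirstInColumn {u : Crossing w} (hu : ¬ IsFirstInColumn w u) :
    u.castSucc ≠ 0 := fun h => hu fun _ ht =>
  absurd ((congrArg Fin.val h : (u : ℕ) = 0) ▸ Fin.lt_def.1 ht) (Nat.not_lt_zero _)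

theorem crossingColumn_eq_of_covBy (hmono : Monotone (crossingColumn w)) {t u : Crossing w}
    (hu : ¬ IsFirstInColumn w u) (htu : t ⋖ u) : crossingColumn w t = crossingColumn w u := by
  simp only [IsFirstInColumn, not_forall, not_not] at hu
  obtain ⟨v, hvu, hv⟩ := hu
  exact (hmono htu.lt.le).antisymm (hv ▸ hmono (htu.le_of_lt hvu))

theorem isMin_fiber_iff {j : Fin k} {t : {t // crossingColumn w t = j}} :
    IsMin t ↔ IsFirstInColumn w t := by
  obtain ⟨t, rfl⟩ := t
  rw [isMin_iff_forall_not_lt, Subtype.forall]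
  exact forall_congr' fun u => ⟨fun h hut hu => h hu hut, fun h hu hut => h hut hu⟩

theorem covBy_fiber_iff (hmono : Monotone (crossingColumn w)) {j : Fin k}
    {t u : {t // crossingColumn w t = j}} : t ⋖ u ↔ t.1 ⋖ u.1 := by
  refine (Set.OrdConnected.apply_covBy_apply_iff
    (OrderEmbedding.subtype (crossingColumn w · = j)) ?_).symm
  rw [OrderEmbedding.coe_subtype]
  exact Subtype.range_coe ▸ (Set.ordConnected_singleton (a := j)).preimage_mono hmono

theorem midColumn_eq_iff {t u : Crossing w} :
    midColumn w t = midColumn w u ↔ crossingColumn w t = crossingColumn w u :=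
  Fin.succ_inj.trans Fin.castSucc_inj

theorem exists_midColumn_eq_of_face_ne {j : Fin (k + 2)} {a b : Level w} (hab : a ≤ b)
    (h : face w j a ≠ face w j b) :
    ∃ t, midColumn w t = j ∧ a ≤ t.castSucc ∧ t.castSucc < b := by
  obtain ⟨t, hat, htb, ht⟩ := exists_apply_castSucc_ne hab h
  by_contra hne
  exact ht (Quot.sound (.pass t j fun htj => hne ⟨t, htj.symm, hat, htb⟩))

theorem face_zero (j : Fin (k + 2)) : face w j 0 = face w j (Fin.last _) :=
  Quot.sound (.close j)

theorem face_eq_upperFace_iff (hmono : Monotone (crossingColumn w)) {u : Crossing w}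
    (hu : ¬ IsFirstInColumn w u) {j : Fin (k + 2)} {l : Level w} :
    face w j l = upperFace w u ↔ j = midColumn w u ∧ l = u.castSucc := by
  refine ⟨fun h => ?_, fun ⟨hj, hl⟩ => hj ▸ hl ▸ rfl⟩
  have hstep {x y : Fin (k + 2) × Level w} (hxy : FaceStep w x y) :
      x = (midColumn w u, u.castSucc) ↔ y = (midColumn w u, u.castSucc) := by
    cases hxy with
    | pass t j hj =>
      simp only [Prod.mk.injEq]
      refine iff_of_false (fun ⟨h, htu⟩ => hj ?_) (fun ⟨h, htu⟩ => hj ?_)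
      · rw [h, Fin.castSucc_injective _ htu]
      · have hcov : t ⋖ u := by simpa [Fin.covBy_iff, Fin.ext_iff] using htu
        rw [h, midColumn_eq_iff.2 (crossingColumn_eq_of_covBy hmono hu hcov)]
    | close j =>
      simp only [Prod.mk.injEq]
      exact iff_of_false (fun ⟨_, h⟩ => castSucc_ne_zero_of_not_isFirstInColumn hu h.symm)
        fun ⟨_, h⟩ => (Fin.castSucc_lt_last u).ne' h
  have hclass := congrArg (Quot.lift (· = (midColumn w u, u.castSucc)) fun _ _ hxy =>
    propext (hstep hxy)) h
  exact Prod.mk.inj (hclass.mpr rfl)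

theorem face_eq_face_zero_or (hmono : Monotone (crossingColumn w)) (j : Fin (k + 2))
    (l : Level w) : face w j l = face w j 0 ∨
      ∃ u, ¬ IsFirstInColumn w u ∧ face w j l = upperFace w u := by
  by_contra! hne
  obtain ⟨a, rfl, -, hal⟩ := exists_midColumn_eq_of_face_ne (Fin.zero_le l) hne.1.symm
  obtain ⟨b, hab, hlb, -⟩ := exists_midColumn_eq_of_face_ne (Fin.le_last l) (face_zero _ ▸ hne.1)
  obtain ⟨u, rfl⟩ := Fin.exists_castSucc_eq.2 (hlb.trans_lt (Fin.castSucc_lt_last b)).ne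
  rw [Fin.castSucc_lt_castSucc_iff] at hal
  rw [Fin.castSucc_le_castSucc_iff] at hlb
  have hau : crossingColumn w a = crossingColumn w u :=
    (hmono hal.le).antisymm (midColumn_eq_iff.1 hab ▸ hmono hlb)
  exact hne.2 u (fun hu => hu a hal hau) (by rw [midColumn_eq_iff.2 hau]; rfl)

end Faces

section Activities

open LaurentPolynomial

variable {k : ℕ} (w : Word k)

/-- The balanced overlaid Tait graph in which the crossings are ordered from top to bottom and the
outer face and the face to the right of the first strand position are omitted. -/
def tait : BalancedOverlaidTait w where
  rank := .refl _
  omittedShaded := face w 1 0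
  omittedUnshaded := face w 0 0
  shaded := show Odd ((1 : Fin (k + 2)) : ℕ) by simp
  unshaded := show ¬ Odd ((0 : Fin (k + 2)) : ℕ) by simp
  touch := ⟨0, 0, .inr ⟨rfl, rfl⟩⟩

open Classical in
/-- The face with which a crossing is matched: the face to the right of its column for the first
crossing of a column, the face above it for every other crossing. -/
noncomputable def matchedFace (u : Crossing w) : Face w :=
  if IsFirstInColumn w u then face w (rightColumn w u) 0 else upperFace w u

variable {w}

theorem matchedFace_of_isFirstInColumn {u : Crossing w} (hu : IsFirstInColumn w u) :
    matchedFace w u = face w (rightColumn w u) 0 :=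
  if_pos hu

theorem matchedFace_of_not_isFirstInColumn {u : Crossing w} (hu : ¬ IsFirstInColumn w u) :
    matchedFace w u = upperFace w u :=
  if_neg hu

theorem face_zero_ne_upperFace (hmono : Monotone (crossingColumn w)) {u : Crossing w}
    (hu : ¬ IsFirstInColumn w u) (j : Fin (k + 2)) : face w j 0 ≠ upperFace w u := fun h =>
  castSucc_ne_zero_of_not_isFirstInColumn hu ((face_eq_upperFace_iff hmono hu).1 h).2.symm

theorem matchedFace_injective (hmono : Monotone (crossingColumn w)) :
    Function.Injective (matchedFace w) := by
  intro t u h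
  by_cases ht : IsFirstInColumn w t <;> by_cases hu : IsFirstInColumn w u
  · rw [matchedFace_of_isFirstInColumn ht, matchedFace_of_isFirstInColumn hu] at h
    refine ht.eq_of_crossingColumn_eq hu (Fin.succ_injective _ (Fin.succ_injective _ ?_))
    exact congrArg Face.column h
  · rw [matchedFace_of_isFirstInColumn ht, matchedFace_of_not_isFirstInColumn hu] at h
    exact absurd h (face_zero_ne_upperFace hmono hu _)
  · rw [matchedFace_of_not_isFirstInColumn ht, matchedFace_of_isFirstInColumn hu] at h
    exact absurd h.symm (face_zero_ne_upperFace hmono ht _)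
  · rw [matchedFace_of_not_isFirstInColumn ht, matchedFace_of_not_isFirstInColumn hu] at h
    exact Fin.castSucc_injective _ ((face_eq_upperFace_iff hmono hu).1 h).2

theorem range_matchedFace (hmono : Monotone (crossingColumn w))
    (hsurj : Function.Surjective (crossingColumn w)) :
    Set.range (matchedFace w) = {f | f ≠ face w 1 0 ∧ f ≠ face w 0 0} := by
  ext f
  constructor
  · rintro ⟨u, rfl⟩
    by_cases hu : IsFirstInColumn w u
    · rw [matchedFace_of_isFirstInColumn hu]
      refine ⟨fun h => ?_, fun h => ?_⟩ <;>
      · have hcolumn := congrArg Fin.val (congrArg Face.column h)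
        simp [Face.column, face, rightColumn] at hcolumn
    · rw [matchedFace_of_not_isFirstInColumn hu]
      exact ⟨(face_zero_ne_upperFace hmono hu 1).symm, (face_zero_ne_upperFace hmono hu 0).symm⟩
  · obtain ⟨⟨j, l⟩, rfl⟩ := Quot.exists_rep f
    rintro ⟨hne1, hne0⟩
    change face w j l ≠ _ at hne1 hne0
    change face w j l ∈ _
    obtain h | ⟨u, hu, h⟩ := face_eq_face_zero_or hmono j l
    · rw [h] at hne1 hne0 ⊢
      obtain ⟨j, rfl⟩ := Fin.exists_succ_eq.2 (ne_of_apply_ne (face w · 0) hne0)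
      obtain ⟨i, rfl⟩ := Fin.exists_succ_eq.2 fun hj : j = 0 => hne1 (hj ▸ rfl)
      obtain ⟨u, hu, rfl⟩ := exists_isFirstInColumn_of_surjective hsurj i
      exact ⟨u, matchedFace_of_isFirstInColumn hu⟩
    · exact ⟨u, h ▸ matchedFace_of_not_isFirstInColumn hu⟩

/-- The matching of the crossings with the remaining faces given by `matchedFace`. -/
noncomputable def matchedFaceEquiv (hmono : Monotone (crossingColumn w))
    (hsurj : Function.Surjective (crossingColumn w)) : Crossing w ≃ (tait w).FaceVertex :=
  (Equiv.ofInjective _ (matchedFace_injective hmono)).trans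
    (Equiv.setCongr (range_matchedFace hmono hsurj))

theorem coe_matchedFaceEquiv (hmono : Monotone (crossingColumn w))
    (hsurj : Function.Surjective (crossingColumn w)) (u : Crossing w) :
    (matchedFaceEquiv hmono hsurj u).1 = matchedFace w u :=
  rfl

theorem crossingColumn_le_of_touches {t u : Crossing w} {l : Level w}
    (h : Touches w t (face w (rightColumn w u) l)) : crossingColumn w u ≤ crossingColumn w t := by
  have hcol : rightColumn w u = midColumn w t ∨ rightColumn w u = midColumn w t ∨
      rightColumn w u = leftColumn w t ∨ rightColumn w u = rightColumn w t :=
    h.imp (congrArg Face.column)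
      (.imp (congrArg Face.column) (.imp (congrArg Face.column) (congrArg Face.column)))
  simp only [rightColumn, midColumn, leftColumn, Fin.ext_iff, Fin.val_succ, Fin.val_castSucc]
    at hcol
  simp only [crossingColumn, Fin.le_def]
  omega

theorem rightFace_eq_face_zero (hmono : Monotone (crossingColumn w)) (t : Crossing w) :
    rightFace w t = face w (rightColumn w t) 0 := by
  by_contra hne
  obtain ⟨u, hu, -, hut⟩ := exists_midColumn_eq_of_face_ne (Fin.zero_le _) (Ne.symm hne)
  have hcol := hmono (Fin.castSucc_lt_castSucc_iff.1 hut).le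
  simp only [rightColumn, midColumn, Fin.ext_iff, Fin.val_succ, Fin.val_castSucc] at hu
  simp only [crossingColumn, Fin.le_def] at hcol
  omega

theorem touches_face_rightColumn (hmono : Monotone (crossingColumn w)) {t u : Crossing w}
    (h : crossingColumn w t = crossingColumn w u) : Touches w t (face w (rightColumn w u) 0) := by
  have hcol : rightColumn w t = rightColumn w u := congrArg (Fin.succ ∘ Fin.succ) h
  exact .inr (.inr (.inr (hcol ▸ rightFace_eq_face_zero hmono t).symm))

theorem lowerFace_eq_upperFace_iff (hmono : Monotone (crossingColumn w)) {t u : Crossing w}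
    (hu : ¬ IsFirstInColumn w u) : lowerFace w t = upperFace w u ↔ t ⋖ u := by
  rw [lowerFace, face_eq_upperFace_iff hmono hu, midColumn_eq_iff]
  have hcov : t.succ = u.castSucc ↔ t ⋖ u := by simp [Fin.covBy_iff, Fin.ext_iff]
  rw [hcov]
  exact and_iff_right_of_imp (crossingColumn_eq_of_covBy hmono hu)

theorem upperFace_eq_upperFace_iff (hmono : Monotone (crossingColumn w)) {t u : Crossing w}
    (hu : ¬ IsFirstInColumn w u) : upperFace w t = upperFace w u ↔ t = u := by
  refine ⟨fun h => ?_, congrArg _⟩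
  exact Fin.castSucc_injective _ ((face_eq_upperFace_iff hmono hu).1 h).2

theorem touches_upperFace_iff (hmono : Monotone (crossingColumn w)) {t u : Crossing w}
    (hu : ¬ IsFirstInColumn w u) : Touches w t (upperFace w u) ↔ t = u ∨ t ⋖ u := by
  have hside {j : Fin (k + 2)} (hj : j = leftColumn w t ∨ j = rightColumn w t) :
      upperFace w u ≠ face w j t.castSucc := fun h => by
    obtain ⟨hmid, hlev⟩ := (face_eq_upperFace_iff hmono hu).1 h.symm
    rw [Fin.castSucc_injective _ hlev] at hj
    simp only [hmid, midColumn, leftColumn, rightColumn, Fin.ext_iff, Fin.val_succ,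
      Fin.val_castSucc] at hj
    omega
  rw [Touches, eq_comm (a := upperFace w u), eq_comm (b := lowerFace w t),
    upperFace_eq_upperFace_iff hmono hu, lowerFace_eq_upperFace_iff hmono hu, leftFace, rightFace,
    or_iff_left (not_or.2 ⟨hside (.inl rfl), hside (.inr rfl)⟩)]

theorem crossingColumn_le_of_touches_matchedFace (hmono : Monotone (crossingColumn w))
    {t u : Crossing w} (h : Touches w t (matchedFace w u)) :
    crossingColumn w u ≤ crossingColumn w t := by
  by_cases hu : IsFirstInColumn w u
  · exact crossingColumn_le_of_touches (matchedFace_of_isFirstInColumn hu ▸ h)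
  · rw [matchedFace_of_not_isFirstInColumn hu, touches_upperFace_iff hmono hu] at h
    obtain rfl | h := h
    · exact le_rfl
    · exact (crossingColumn_eq_of_covBy hmono hu h).ge

theorem le_add_one_of_touches_matchedFace (hmono : Monotone (crossingColumn w))
    {t u : Crossing w} (h : Touches w t (matchedFace w u)) : (u : ℕ) ≤ t + 1 := by
  by_cases hu : IsFirstInColumn w u
  · have hut := hu.le_of_crossingColumn_le hmono (crossingColumn_le_of_touches_matchedFace hmono h)
    exact (Fin.le_def.1 hut).trans (Nat.le_succ _)
  · rw [matchedFace_of_not_isFirstInColumn hu, touches_upperFace_iff hmono hu] at h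
    obtain rfl | h := h
    · exact Nat.le_succ _
    · simp only [Fin.covBy_iff, Nat.covBy_iff_add_one_eq] at h
      exact h.ge

theorem isLeast_touches_face_rightColumn (hmono : Monotone (crossingColumn w)) {u : Crossing w}
    (hu : IsFirstInColumn w u) : IsLeast {t | Touches w t (face w (rightColumn w u) 0)} u :=
  ⟨touches_face_rightColumn hmono rfl,
    fun _ ht => hu.le_of_crossingColumn_le hmono (crossingColumn_le_of_touches ht)⟩

theorem isLeast_touches_upperFace_iff (hmono : Monotone (crossingColumn w)) {t u : Crossing w}
    (hu : ¬ IsFirstInColumn w u) : IsLeast {t | Touches w t (upperFace w u)} t ↔ t ⋖ u := by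
  simp only [touches_upperFace_iff hmono hu]
  constructor
  · rintro ⟨rfl | ht, hle⟩
    · simp only [IsFirstInColumn, not_forall] at hu
      obtain ⟨v, hv, -⟩ := hu
      obtain ⟨a, -, ha⟩ := exists_le_covBy_of_lt hv
      exact absurd (hle (.inr ha)) ha.lt.not_ge
    · exact ht
  · rintro ht
    refine ⟨.inr ht, ?_⟩
    rintro v (rfl | hv)
    · exact ht.le
    · exact (ht.unique_left hv).le

theorem isLowest_tait_iff {t : Crossing w} {f : (tait w).FaceVertex} :
    (tait w).IsLowest t f ↔ IsLeast {t | Touches w t f.1} t :=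
  Iff.rfl

theorem shaded_leftFace_iff (t : Crossing w) :
    (leftFace w t).Shaded ↔ ¬ (upperFace w t).Shaded := by
  change Odd ((w.get t).1 : ℕ) ↔ ¬ Odd ((w.get t).1 + 1 : ℕ)
  rw [Nat.odd_add_one, not_not]

open Classical in
theorem BalancedOverlaidTait.weight_eq (G : BalancedOverlaidTait w) (t : Crossing w)
    (f : G.FaceVertex) :
    G.weight t f =
      if f.1.Shaded ↔ (upperFace w t).Shaded then
        if G.IsLowest t f then -T (-(sign w t : ℤ)) ^ 3 else T (sign w t)
      else if G.IsLowest t f then -T (sign w t : ℤ) ^ 3 else T (-(sign w t : ℤ)) := by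
  rw [weight, letter, CheckerboardPositive, shaded_leftFace_iff]
  simp only [T_pow]
  obtain h | h := Int.units_eq_one_or (sign w t) <;>
    by_cases hu : (upperFace w t).Shaded <;> by_cases hf : f.1.Shaded <;>
    by_cases hl : G.IsLowest t f <;> simp [h, hu, hf, hl, ActivityLetter.specialize]

theorem shaded_upperFace_iff_of_crossingColumn_eq {t u : Crossing w}
    (htu : crossingColumn w t = crossingColumn w u) :
    (upperFace w t).Shaded ↔ (upperFace w u).Shaded := by
  have h : (upperFace w t).column = (upperFace w u).column := midColumn_eq_iff.2 htu
  rw [Face.Shaded, Face.Shaded, h]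

theorem shaded_face_rightColumn_iff {u : Crossing w} {l : Level w} :
    (face w (rightColumn w u) l).Shaded ↔ ¬ (upperFace w u).Shaded := by
  change Odd ((w.get u).1 + 1 + 1 : ℕ) ↔ ¬ Odd ((w.get u).1 + 1 : ℕ)
  exact Nat.odd_add_one

open Classical in
theorem weight_of_isFirstInColumn (hmono : Monotone (crossingColumn w)) {t u : Crossing w}
    {f : (tait w).FaceVertex} (hu : IsFirstInColumn w u) (hf : f.1 = face w (rightColumn w u) 0)
    (htu : crossingColumn w t = crossingColumn w u) :
    (tait w).weight t f =
      if IsFirstInColumn w t then -T (sign w t : ℤ) ^ 3 else T (-(sign w t : ℤ)) := by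
  have hlow : (tait w).IsLowest t f ↔ IsFirstInColumn w t := by
    rw [isLowest_tait_iff, hf]
    refine ⟨fun h => ?_, fun ht => ?_⟩
    · rwa [h.unique (isLeast_touches_face_rightColumn hmono hu)]
    · rw [ht.eq_of_crossingColumn_eq hu htu]
      exact isLeast_touches_face_rightColumn hmono hu
  have hshaded : ¬ (f.1.Shaded ↔ (upperFace w t).Shaded) := by
    rw [hf, shaded_face_rightColumn_iff, shaded_upperFace_iff_of_crossingColumn_eq htu]
    exact not_iff_self
  rw [BalancedOverlaidTait.weight_eq, if_neg hshaded, hlow]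

open Classical in
theorem weight_of_not_isFirstInColumn (hmono : Monotone (crossingColumn w)) {t u : Crossing w}
    {f : (tait w).FaceVertex} (hu : ¬ IsFirstInColumn w u) (hf : f.1 = upperFace w u)
    (htu : crossingColumn w t = crossingColumn w u) :
    (tait w).weight t f =
      if t ⋖ u then -T (-(sign w t : ℤ)) ^ 3 else T (sign w t : ℤ) := by
  have hshaded : f.1.Shaded ↔ (upperFace w t).Shaded := by
    rw [hf, shaded_upperFace_iff_of_crossingColumn_eq htu]
  rw [BalancedOverlaidTait.weight_eq, if_pos hshaded, isLowest_tait_iff, hf,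
    isLeast_touches_upperFace_iff hmono hu]

end Activities

section Assembly

open LaurentPolynomial

variable {k : ℕ} {w : Word k} (hmono : Monotone (crossingColumn w))
  (hsurj : Function.Surjective (crossingColumn w))

open Classical in
theorem activityMatrix_tait_of_crossingColumn_eq {t u : Crossing w}
    (htu : crossingColumn w t = crossingColumn w u) :
    (tait w).activityMatrix t (matchedFaceEquiv hmono hsurj u) =
      if IsFirstInColumn w u then
        if IsFirstInColumn w t then -T (sign w t : ℤ) ^ 3 else T (-(sign w t : ℤ))
      else if u = t then T (sign w t : ℤ)
      else if t ⋖ u then -T (-(sign w t : ℤ)) ^ 3 else 0 := by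
  rw [BalancedOverlaidTait.activityMatrix, Matrix.of_apply, coe_matchedFaceEquiv]
  by_cases hu : IsFirstInColumn w u
  · have hf := matchedFace_of_isFirstInColumn hu
    rw [hf, if_pos (touches_face_rightColumn hmono htu), if_pos hu,
      weight_of_isFirstInColumn hmono hu hf htu]
  · have hf := matchedFace_of_not_isFirstInColumn hu
    rw [hf, touches_upperFace_iff hmono hu, if_neg hu,
      weight_of_not_isFirstInColumn hmono hu hf htu]
    obtain rfl | hne := eq_or_ne u t
    · simp
    · simp only [hne, hne.symm, false_or, if_false]
      split_ifs <;> rfl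

theorem activityMatrix_tait_eq_zero {t u : Crossing w}
    (h : ¬ Touches w t (matchedFace w u)) :
    (tait w).activityMatrix t (matchedFaceEquiv hmono hsurj u) = 0 :=
  if_neg h

/-- The activity matrix, with its columns indexed by the matched crossings and the signs of its
entries above the diagonal reversed. -/
noncomputable def signedActivityMatrix : Matrix (Crossing w) (Crossing w) (LaurentPolynomial ℤ) :=
  .of fun t u => if t < u then -(tait w).activityMatrix t (matchedFaceEquiv hmono hsurj u)
    else (tait w).activityMatrix t (matchedFaceEquiv hmono hsurj u)

theorem partitionFunction_tait :
    (tait w).partitionFunction = (signedActivityMatrix hmono hsurj).det := by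
  rw [BalancedOverlaidTait.partitionFunction_eq_permanent (matchedFaceEquiv hmono hsurj)]
  refine permanent_eq_det_of_hessenberg fun t u htu => ?_
  exact activityMatrix_tait_eq_zero hmono hsurj fun h =>
    htu.not_ge (le_add_one_of_touches_matchedFace hmono h)

theorem signedActivityMatrix_eq_zero {t u : Crossing w}
    (htu : crossingColumn w t < crossingColumn w u) : signedActivityMatrix hmono hsurj t u = 0 := by
  have hzero := activityMatrix_tait_eq_zero hmono hsurj fun h =>
    htu.not_ge (crossingColumn_le_of_touches_matchedFace hmono h)
  simp only [signedActivityMatrix, Matrix.of_apply, hzero, neg_zero, ite_self]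

open Classical in
theorem signedActivityMatrix_of_crossingColumn_eq {t u : Crossing w}
    (htu : crossingColumn w t = crossingColumn w u) :
    signedActivityMatrix hmono hsurj t u =
      if IsFirstInColumn w u then
        if IsFirstInColumn w t then -T (sign w t : ℤ) ^ 3 else T (-(sign w t : ℤ))
      else if u = t then T (sign w t : ℤ)
      else if t ⋖ u then T (-(sign w t : ℤ)) ^ 3 else 0 := by
  rw [signedActivityMatrix, Matrix.of_apply,
    activityMatrix_tait_of_crossingColumn_eq hmono hsurj htu]
  by_cases hu : IsFirstInColumn w u
  · rw [if_neg (hu.le_of_crossingColumn_le hmono htu.ge).not_gt, if_pos hu, if_pos hu]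
  · by_cases hcov : t ⋖ u
    · simp only [hu, hcov, hcov.lt, hcov.ne', if_true, if_false, neg_neg]
    · simp only [hu, hcov, if_false]
      obtain rfl | hne := eq_or_ne u t
      · simp only [lt_irrefl, if_true, if_false]
      · simp only [hne, if_false, neg_zero, ite_self]

theorem det_signedActivityMatrix : (signedActivityMatrix hmono hsurj).det = bracket w := by
  rw [bracket_eq_prod_columnBracket hmono, det_eq_prod_det_toSquareBlock
    (b := crossingColumn w) fun t u => signedActivityMatrix_eq_zero hmono hsurj]
  refine Finset.prod_congr rfl fun j _ => ?_
  have : Nonempty {t // crossingColumn w t = j} := nonempty_subtype.2 (hsurj j)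
  refine (congrArg Matrix.det ?_).trans (det_columnMatrix_eq_columnBracket _)
  refine Matrix.ext fun t u => ?_
  rw [Matrix.toSquareBlock_def, Matrix.of_apply,
    signedActivityMatrix_of_crossingColumn_eq hmono hsurj (t.2.trans u.2.symm), columnMatrix,
    Matrix.of_apply, covBy_fiber_iff hmono, isMin_fiber_iff, isMin_fiber_iff, Subtype.ext_iff]
  congr

include hmono hsurj in
theorem tait_isDimerModel : (tait w).IsDimerModel :=
  (partitionFunction_tait hmono hsurj).trans (det_signedActivityMatrix hmono hsurj)

theorem kauffmanSignedMatrix_tait_eq_zero {t u : Crossing w}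
    (htu : crossingColumn w t < crossingColumn w u) :
    (tait w).kauffmanSignedMatrix t (matchedFaceEquiv hmono hsurj u) = 0 :=
  if_neg fun h => htu.not_ge (crossingColumn_le_of_touches_matchedFace hmono h)

open Classical in
theorem kauffmanSignedMatrix_tait_of_crossingColumn_eq {t u : Crossing w}
    (htu : crossingColumn w t = crossingColumn w u) :
    (tait w).kauffmanSignedMatrix t (matchedFaceEquiv hmono hsurj u) =
      (if IsFirstInColumn w u then 1 else -1) * signedActivityMatrix hmono hsurj t u := by
  rw [BalancedOverlaidTait.kauffmanSignedMatrix_eq_activityMatrix, signedActivityMatrix,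
    Matrix.of_apply, coe_matchedFaceEquiv]
  by_cases hu : IsFirstInColumn w u
  · have hne : face w (rightColumn w u) 0 ≠ upperFace w t := fun h => by
      have hshaded := shaded_upperFace_iff_of_crossingColumn_eq htu
      rw [← h, shaded_face_rightColumn_iff] at hshaded
      exact not_iff_self hshaded
    rw [matchedFace_of_isFirstInColumn hu, if_neg hne, if_pos hu, one_mul,
      if_neg (hu.le_of_crossingColumn_le hmono htu.ge).not_gt]
  · rw [matchedFace_of_not_isFirstInColumn hu, eq_comm (a := upperFace w u),
      upperFace_eq_upperFace_iff hmono hu, if_neg hu, neg_one_mul]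
    obtain hlt | rfl | hgt := lt_trichotomy t u
    · rw [if_neg hlt.ne, if_pos hlt, neg_neg]
    · rw [if_pos rfl, if_neg (lt_irrefl _)]
    · have hzero := activityMatrix_tait_eq_zero hmono hsurj (t := t) (u := u) <| by
        rw [matchedFace_of_not_isFirstInColumn hu, touches_upperFace_iff hmono hu]
        exact not_or.2 ⟨hgt.ne', fun h => hgt.asymm h.lt⟩
      simp only [hzero, neg_zero, ite_self]

theorem exists_bracket_eq_smul_det_kauffmanSignedMatrix_tait :
    ∃ ε : ℤˣ, bracket w =
      ε • ((tait w).kauffmanSignedMatrix.submatrix id (matchedFaceEquiv hmono hsurj)).det := by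
  classical
  let ε : ℤˣ := ∏ u : Crossing w, if IsFirstInColumn w u then 1 else -1
  refine ⟨ε, ?_⟩
  have hε : ((ε : ℤ) : LaurentPolynomial ℤ) = ∏ u, if IsFirstInColumn w u then 1 else -1 := by
    simp [ε, Units.coe_prod, apply_ite]
  have hdet := det_eq_prod_mul_det_of_toSquareBlock
    (M := (tait w).kauffmanSignedMatrix.submatrix id (matchedFaceEquiv hmono hsurj))
    (N := signedActivityMatrix hmono hsurj) (b := crossingColumn w)
    (v := fun u => if IsFirstInColumn w u then 1 else -1)
    (fun _ _ => kauffmanSignedMatrix_tait_eq_zero hmono hsurj)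
    (fun _ _ => signedActivityMatrix_eq_zero hmono hsurj)
    fun _ _ => kauffmanSignedMatrix_tait_of_crossingColumn_eq hmono hsurj
  rw [hdet, ← hε, det_signedActivityMatrix, ← zsmul_eq_mul, ← Units.smul_def, smul_smul,
    Int.units_mul_self, one_smul]

end Assembly

section PowerWord

variable {k : ℕ} (m : Fin k → ℤ)

theorem monotone_crossingColumn_powerWord : Monotone (crossingColumn (powerWord m)) := by
  have hsorted : (powerWord m).Pairwise fun a b => a.1 ≤ b.1 := by
    rw [powerWord, List.pairwise_flatMap]
    refine ⟨fun i _ => List.pairwise_replicate.2 (.inr le_rfl), ?_⟩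
    refine (List.pairwise_lt_finRange k).imp fun hij a ha b hb => ?_
    rw [List.eq_of_mem_replicate ha, List.eq_of_mem_replicate hb]
    exact hij.le
  exact fun t u htu => htu.eq_or_lt.elim (fun h => h ▸ le_rfl) (List.pairwise_iff_get.1 hsorted t u)

variable {m}

theorem surjective_crossingColumn_powerWord (hm : ∀ i, m i ≠ 0) :
    Function.Surjective (crossingColumn (powerWord m)) := by
  intro i
  have hmem : (i, if 0 < m i then 1 else -1) ∈ powerWord m :=
    List.mem_flatMap.2
      ⟨i, List.mem_finRange i, List.mem_replicate.2 ⟨Int.natAbs_ne_zero.2 (hm i), rfl⟩⟩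
  obtain ⟨t, ht⟩ := List.get_of_mem hmem
  exact ⟨t, congrArg Prod.fst ht⟩

end PowerWord

end ClosedBraid

theorem mainTheorem1_general {k : ℕ} (w : ClosedBraid.Word k)
    (hmono : Monotone (ClosedBraid.crossingColumn w))
    (hsurj : Function.Surjective (ClosedBraid.crossingColumn w)) :
    ∃ G : ClosedBraid.BalancedOverlaidTait w,
      G.IsDimerModel ∧
      Nonempty (ClosedBraid.Crossing w ≃ G.FaceVertex) ∧
      ∀ e : ClosedBraid.Crossing w ≃ G.FaceVertex, ∃ u : ℤˣ,
        ClosedBraid.jones w =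
          u • (ClosedBraid.writheFactor w * (G.kauffmanSignedMatrix.submatrix id e).det) := by
  let e₀ := ClosedBraid.matchedFaceEquiv hmono hsurj
  refine ⟨ClosedBraid.tait w, ClosedBraid.tait_isDimerModel hmono hsurj, ⟨e₀⟩, fun e => ?_⟩
  obtain ⟨ε, hε⟩ :=
    ClosedBraid.exists_bracket_eq_smul_det_kauffmanSignedMatrix_tait hmono hsurj
  obtain ⟨δ, hδ⟩ := ClosedBraid.exists_det_submatrix_eq_smul_det_submatrix
    (ClosedBraid.tait w).kauffmanSignedMatrix e₀ e
  exact ⟨ε * δ, by rw [ClosedBraid.jones, hε, hδ, smul_smul, mul_smul_comm]⟩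

/-- The closed braid `σ₁^{m₁} ⋯ σ_k^{m_k}` on `k + 1` strands with exponents all positive or all
negative has a dimer model, and up to sign its Jones polynomial is the writhe correction times the
determinant of the activity matrix with the signs of Kauffman's trick, for every identification of the rows with the
columns of this (square) matrix. -/
theorem mainTheorem1 (k : ℕ) (m : Fin k → ℤ) (hm : (∀ i, 0 < m i) ∨ (∀ i, m i < 0)) :
    ∃ G : ClosedBraid.BalancedOverlaidTait (ClosedBraid.powerWord m),
      G.IsDimerModel ∧
      Nonempty (ClosedBraid.Crossing (ClosedBraid.powerWord m) ≃ G.FaceVertex) ∧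
      ∀ e : ClosedBraid.Crossing (ClosedBraid.powerWord m) ≃ G.FaceVertex, ∃ u : ℤˣ,
        ClosedBraid.jones (ClosedBraid.powerWord m) =
          u • (ClosedBraid.writheFactor (ClosedBraid.powerWord m) *
            (G.kauffmanSignedMatrix.submatrix id e).det) :=
  mainTheorem1_general _ (ClosedBraid.monotone_crossingColumn_powerWord m) <|
    ClosedBraid.surjective_crossingColumn_powerWord fun i =>
      hm.elim (fun h => (h i).ne') fun h => (h i).ne
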